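/- All graphs are finite and simple, and $\log$ denotes the logarithm to base $2$. The size of a path is the number of its vertices. A graph is outerplanar if it can be drawn in the plane without crossing edges and with all vertices on the (boundary of the) external face. A block of a graph is a maximal $2$-connected induced subgraph, where a $2$-connected graph has at least three vertices and a bridge (with its two ends) also counts as a block. A bracelet is a connected outerplanar graph in which every cut-vertex lies in exactly two blocks and every block contains at most two cut-vertices. Lemma 3.4. Let $G$ be a bracelet with $n \ge 2$ vertices. Then $G$ contains an induced path of size at least $\frac12(\log n - \log\log n)$. Moreover $\frac12(\log n - \log\log n) = (\frac12 - o(1))\log n$ as $n \to \infty$. -/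

import Mathlib

open SimpleGraph Filter Topology

/-- The Euclidean plane. -/
abbrev Plane : Type := EuclideanSpace ℝ (Fin 2)

/-- A drawing of the graph `G` in the plane without crossing edges: distinct vertices are distinct
points, every edge is a simple arc joining its two ends, an edge contains no vertex other than its
ends, and two distinct edges meet only in common ends. -/
structure PlaneDrawing {V : Type*} (G : SimpleGraph V) where
  /-- the point that represents a vertex -/
  pos : V → Plane
  /-- the arc that represents an edge, parametrized from `u` to `v` -/
  arc : ∀ {u v : V}, G.Adj u v → Path (pos u) (pos v)
  pos_injective : Function.Injective pos
  /-- the two orientations of an edge are drawn as the same arc -/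
  arc_symm : ∀ {u v : V} (h : G.Adj u v), arc h.symm = (arc h).symm
  arc_injective : ∀ {u v : V} (h : G.Adj u v), Function.Injective (arc h)
  vertex_on_arc : ∀ {u v w : V} (h : G.Adj u v), pos w ∈ Set.range (arc h) → w = u ∨ w = v
  arc_inter_arc : ∀ {u v x y : V} (h : G.Adj u v) (h' : G.Adj x y), s(u, v) ≠ s(x, y) →
    ∀ p ∈ Set.range (arc h) ∩ Set.range (arc h'), ∃ w, w ∈ s(u, v) ∧ w ∈ s(x, y) ∧ p = pos w

namespace PlaneDrawing

variable {V : Type*} {G : SimpleGraph V}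

/-- The set of all points of the plane that lie on the drawing. -/
def support (D : PlaneDrawing G) : Set Plane :=
  Set.range D.pos ∪ {p | ∃ (u v : V) (h : G.Adj u v), p ∈ Set.range (D.arc h)}

/-- The faces of a drawing are the connected components of the complement of the drawing. -/
def IsFace (D : PlaneDrawing G) (F : Set Plane) : Prop :=
  ∃ p ∈ D.supportᶜ, F = connectedComponentIn D.supportᶜ p

/-- The external face is the unbounded one. -/
def IsExternalFace (D : PlaneDrawing G) (F : Set Plane) : Prop :=
  D.IsFace F ∧ ¬ Bornology.IsBounded F

end PlaneDrawing

namespace SimpleGraph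

variable {V : Type*}

/-- `G` can be drawn in the plane without crossing edges and with all vertices on (the boundary of)
the external face. -/
def IsOuterplanar (G : SimpleGraph V) : Prop :=
  ∃ (D : PlaneDrawing G) (F : Set Plane), D.IsExternalFace F ∧ ∀ v, D.pos v ∈ frontier F

/-- `v` is a cut-vertex: deleting `v` disconnects two other vertices of one component of `G`. -/
def IsCutVertex (G : SimpleGraph V) (v : V) : Prop :=
  ∃ a b : ({v}ᶜ : Set V), G.Reachable a b ∧ ¬ (G.induce {v}ᶜ).Reachable a b

/-- `G` is `2`-connected: it has at least three vertices, is connected, and stays connected when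
any one vertex is deleted. -/
def IsTwoConnected (G : SimpleGraph V) : Prop :=
  3 ≤ ENat.card V ∧ G.Connected ∧ ∀ v, (G.induce {v}ᶜ).Connected

/-- `B` is the vertex set of a block of `G`: a maximal `2`-connected induced subgraph, or a
bridge. -/
def IsBlock (G : SimpleGraph V) (B : Set V) : Prop :=
  Maximal (fun S : Set V => (G.induce S).IsTwoConnected) B ∨
    ∃ u v, G.Adj u v ∧ G.IsBridge s(u, v) ∧ B = {u, v}

/-- A bracelet: a connected outerplanar graph in which each cut-vertex lies in exactly two blocks
and each block contains at most two cut-vertices. -/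
def IsBracelet (G : SimpleGraph V) : Prop :=
  G.Connected ∧ G.IsOuterplanar ∧
    (∀ v, G.IsCutVertex v → {B : Set V | G.IsBlock B ∧ v ∈ B}.encard = 2) ∧
    (∀ B, G.IsBlock B → {v | v ∈ B ∧ G.IsCutVertex v}.encard ≤ 2)

/-- `G` contains an induced path of size `k`, that is, on `k` vertices. -/
def HasInducedPath (G : SimpleGraph V) (k : ℕ) : Prop :=
  Nonempty (pathGraph k ↪g G)

end SimpleGraph

/-! ### Continuous logarithms and drawings of `K₅` and `K₃,₃` -/

/-! Outerplanarity enters only through two forbidden configurations. Some point of the external face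
can be joined to each vertex `a` by a curve that avoids everything drawn on the other vertices
(`PlaneDrawing.exists_apex`). With this apex added, three disjoint connected sets attached to the
same two further vertices would yield a K₃,₃ whose independent edges are disjoint
(`IsOuterplanar.thetaFree`), and two adjacent connected sets attached to both ends of an edge would
yield such a K₅ (`IsOuterplanar.edgeK4Free`). A parity argument with winding numbers excludes both,
so the Jordan curve theorem is not needed.

In a 2-connected graph, consider a component `D` left after deleting the ends of an edge `uv`. A
shortest detour from `u` to `v` through `D`, with `r` edges, closes a cycle with `uv`. The forbidden
configurations force each remaining component to hang on one edge of the detour, and different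
components on different edges. Recursing into the largest one and extending its two induced paths
along the two parts of the detour adds `r - 1` vertices in total, while `|D| + 1` exceeds its
successor by a factor of at most `r ≤ 2 ^ (r - 1)`. Hence the two paths together have at least `log
(|D| + 1)` vertices besides `u` and `v`, and the longer has at least half of them
(`IsLobe.exists_induced_paths`).

In a bracelet the blocks form a chain. Going from a cut-vertex into its larger side, an induced path
crosses `t` blocks and gains a vertex in each, and the largest block `B` met satisfies `n ≤ 2 * t *
|B|` (`IsBracelet.exists_path_and_biconn`). If `2 * t > log n`, the crossing path is long enough.
Otherwise `|B| ≥ n / log n`, and the 2-connected case inside `B` gives the bound. -/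

open unitInterval in
theorem exists_continuous_log_square (f : I × I → ℂ) (hf : Continuous f) (h0 : ∀ x, f x ≠ 0) :
    ∃ L : I × I → ℂ, Continuous L ∧ ∀ x, Complex.exp (L x) = f x := by
  -- Clamping the coordinates extends `f` to the whole plane, where it lifts through the covering
  -- `exp`. Restricting the lift gives `L`.
  let pr : ℝ × ℝ → I × I := fun x =>
    (Set.projIcc 0 1 zero_le_one x.1, Set.projIcc 0 1 zero_le_one x.2)
  have hpr : Continuous pr := by
    have := @continuous_projIcc ℝ _ 0 1 zero_le_one _ _
    exact (this.comp continuous_fst).prodMk (this.comp continuous_snd)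
  obtain ⟨F, ⟨-, hF⟩, -⟩ := Complex.isCoveringMapOn_exp.existsUnique_continuousMap_lifts
    (⟨f ∘ pr, hf.comp hpr⟩ : C(ℝ × ℝ, ℂ)) (a₀ := 0) (Complex.exp_log (h0 (pr 0)))
    (fun x => h0 _)
  refine ⟨fun x => F (x.1, x.2), by fun_prop, fun x => ?_⟩
  have := congrFun hF (x.1, x.2)
  simpa [pr] using this

/-- `a` is the total change of a continuous logarithm of `z - w` as `z` runs along `γ`. -/
def IsLogChange {x y : ℂ} (γ : Path x y) (w a : ℂ) : Prop :=
  ∃ L : unitInterval → ℂ, Continuous L ∧ (∀ t, Complex.exp (L t) = γ t - w) ∧ L 1 - L 0 = a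

/-- Two logarithms of one function differ by an integer multiple of `2πi`; the integer depends
continuously on the parameter, so it is constant on the interval. -/
theorem continuous_log_diff_const {L M : unitInterval → ℂ} (hL : Continuous L) (hM : Continuous M)
    (h : ∀ t, Complex.exp (L t) = Complex.exp (M t)) : L 1 - L 0 = M 1 - M 0 := by
  have h1 : ∀ t, ∃ n : ℤ, L t = M t + n * (2 * Real.pi * Complex.I) := fun t =>
    Complex.exp_eq_exp_iff_exists_int.1 (h t)
  choose n hn using h1
  have hpi : (2 * Real.pi * Complex.I : ℂ) ≠ 0 := Complex.two_pi_I_ne_zero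
  have hc : Continuous fun t => ((n t : ℤ) : ℝ) := by
    have : (fun t => ((n t : ℤ) : ℝ)) =
        fun t => ((L t - M t) / (2 * Real.pi * Complex.I)).re := by
      funext t
      have : (L t - M t) / (2 * Real.pi * Complex.I) = ((n t : ℝ) : ℂ) := by
        rw [div_eq_iff hpi, hn t]; push_cast; ring
      rw [this, Complex.ofReal_re]
    rw [this]
    fun_prop
  have hcn : Continuous n := Int.isClosedEmbedding_coe_real.isEmbedding.continuous_iff.2 hc
  have : n 1 = n 0 := PreconnectedSpace.constant inferInstance hcn
  rw [hn 1, hn 0, this]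
  ring

theorem IsLogChange.unique {x y w a b : ℂ} {γ : Path x y} (ha : IsLogChange γ w a)
    (hb : IsLogChange γ w b) : a = b := by
  obtain ⟨L, hL, hL', rfl⟩ := ha
  obtain ⟨M, hM, hM', rfl⟩ := hb
  exact continuous_log_diff_const hL hM fun t => by rw [hL', hM']

theorem IsLogChange.exp_eq {x y w a : ℂ} {γ : Path x y} (ha : IsLogChange γ w a) :
    Complex.exp a = (y - w) / (x - w) := by
  obtain ⟨L, hL, hL', rfl⟩ := ha
  rw [Complex.exp_sub, hL', hL', γ.target, γ.source]

-- Since `γ s - δ t` never vanishes, it has a continuous logarithm on the square. Its increments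
-- along the four sides are the four log changes, and they cancel around the boundary. On the sides
-- where `δ` moves, adding `πi` turns `γ - δ` into `δ - γ`.
open unitInterval in
theorem exists_isLogChange_rectangle {x y u v : ℂ} (γ : Path x y) (δ : Path u v)
    (h : Disjoint (Set.range γ) (Set.range δ)) :
    ∃ a b c d, IsLogChange γ v a ∧ IsLogChange γ u b ∧ IsLogChange δ y c ∧ IsLogChange δ x d ∧
      a - b = c - d := by
  obtain ⟨L, hL, hL'⟩ := exists_continuous_log_square (fun t : I × I => γ t.1 - δ t.2)
    (by fun_prop) (fun t ht => Set.disjoint_left.1 h ⟨t.1, rfl⟩ ⟨t.2, (sub_eq_zero.1 ht).symm⟩)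
  have key : ∀ s t, Complex.exp (L (s, t) + Real.pi * Complex.I) = δ t - γ s := fun s t => by
    rw [Complex.exp_add, hL', Complex.exp_pi_mul_I]; simp
  refine ⟨L (1, 1) - L (0, 1), L (1, 0) - L (0, 0), L (1, 1) - L (1, 0), L (0, 1) - L (0, 0),
    ⟨fun s => L (s, 1), by fun_prop, fun s => by simp [hL'], rfl⟩,
    ⟨fun s => L (s, 0), by fun_prop, fun s => by simp [hL'], rfl⟩,
    ⟨fun t => L (1, t) + Real.pi * Complex.I, by fun_prop, fun t => by rw [key]; simp, by ring⟩,
    ⟨fun t => L (0, t) + Real.pi * Complex.I, by fun_prop, fun t => by rw [key]; simp, by ring⟩,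
    by ring⟩

/-- `1` if `a` comes before `b`, otherwise `-1`. -/
def orderSign {ι : Type*} (ord : ι → ℕ) (a b : ι) : ℤ := if ord a < ord b then 1 else -1

/-- If curves joining points of the plane are such that independent ones are disjoint, then the
winding numbers of the curves around the points satisfy one parity relation for each pair of
independent curves. -/
theorem exists_winding_numbers {ι : Type*} (ord : ι → ℕ) (hord : Function.Injective ord)
    (z : ι → ℂ) (hz : Function.Injective z) (E : ι → ι → Prop)
    (γ : ∀ i j, E i j → Path (z i) (z j))
    (hγ : ∀ i j k l (h : E i j) (h' : E k l), i ≠ k → i ≠ l → j ≠ k → j ≠ l →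
      Disjoint (Set.range (γ i j h)) (Set.range (γ k l h'))) :
    ∃ n : ι → ι → ι → ℤ, ∀ i j k l, E i j → E k l → i ≠ k → i ≠ l → j ≠ k → j ≠ l →
      2 * (n i j l - n i j k - n k l j + n k l i) = orderSign ord j l - orderSign ord i l -
        orderSign ord j k + orderSign ord i k := by
  classical
  -- A fixed logarithm of `z a - z b`, chosen so that swapping `a` and `b` changes it by exactly
  -- `±πi`. These half turns are the only terms that survive in the rectangle relation, and they
  -- create the parity.
  let ℓ : ι → ι → ℂ := fun a b => if ord a < ord b then Complex.log (z a - z b) else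
    Complex.log (z b - z a) + Real.pi * Complex.I
  have hℓ : ∀ a b, a ≠ b → Complex.exp (ℓ a b) = z a - z b := by
    intro a b hab
    by_cases h : ord a < ord b
    · simp only [ℓ, if_pos h]
      exact Complex.exp_log (sub_ne_zero.2 (hz.ne hab))
    · simp only [ℓ, if_neg h]
      rw [Complex.exp_add, Complex.exp_log (sub_ne_zero.2 (hz.ne hab.symm)), Complex.exp_pi_mul_I]
      ring
  have hℓs : ∀ a b, a ≠ b → ℓ b a - ℓ a b = orderSign ord a b * (Real.pi * Complex.I) := by
    intro a b hab
    rcases lt_or_gt_of_ne (hord.ne hab) with h | h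
    · simp [ℓ, orderSign, h, not_lt.2 h.le]
    · simp [ℓ, orderSign, h, not_lt.2 h.le]
  have hn : ∀ i j w, ∃ m : ℤ, ∀ (h : E i j) (a : ℂ), w ≠ i → w ≠ j → IsLogChange (γ i j h) (z w) a →
      a = ℓ j w - ℓ i w + m * (2 * Real.pi * Complex.I) := by
    intro i j w
    by_cases h : ∃ (h : E i j) (a : ℂ), w ≠ i ∧ w ≠ j ∧ IsLogChange (γ i j h) (z w) a
    · obtain ⟨h, a, hi, hj, ha⟩ := h
      have : Complex.exp a = Complex.exp (ℓ j w - ℓ i w) := by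
        rw [ha.exp_eq, Complex.exp_sub, hℓ _ _ hi.symm, hℓ _ _ hj.symm]
      obtain ⟨m, hm⟩ := Complex.exp_eq_exp_iff_exists_int.1 this
      exact ⟨m, fun _ b _ _ hb => (hb.unique ha).trans hm⟩
    · push Not at h
      -- Default value where there is no log change to describe; the claim is vacuous there.
      exact ⟨0, fun hE a hi hj ha => absurd ha (h hE a hi hj)⟩
  choose n hn using hn
  refine ⟨n, fun i j k l h h' hik hil hjk hjl => ?_⟩
  obtain ⟨a, b, c, d, ha, hb, hc, hd, e⟩ := exists_isLogChange_rectangle _ _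
    (hγ i j k l h h' hik hil hjk hjl)
  rw [hn _ _ _ h a hil.symm hjl.symm ha, hn _ _ _ h b hik.symm hjk.symm hb,
    hn _ _ _ h' c hjk hjl hc, hn _ _ _ h' d hik hil hd] at e
  have hpi : (Real.pi * Complex.I : ℂ) ≠ 0 := by simp [Real.pi_ne_zero]
  have : ((2 * (n i j l - n i j k - n k l j + n k l i) : ℤ) : ℂ) * (Real.pi * Complex.I) =
      ((orderSign ord j l - orderSign ord i l - orderSign ord j k + orderSign ord i k : ℤ) : ℂ) *
        (Real.pi * Complex.I) := by
    push_cast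
    linear_combination e + hℓs j l hjl - hℓs i l hil - hℓs j k hjk + hℓs i k hik
  exact_mod_cast mul_right_cancel₀ hpi this

/-- `K₅` has no drawing in which independent edges are disjoint. -/
theorem not_exists_K5_drawing (z : Fin 5 → ℂ) (hz : Function.Injective z)
    (R : Fin 5 → Fin 5 → Set ℂ)
    (hγ : ∀ i j, i < j → ∃ γ : Path (z i) (z j), Set.range γ ⊆ R i j)
    (hR : ∀ i j k l, i < j → k < l → i ≠ k → i ≠ l → j ≠ k → j ≠ l →
      Disjoint (R i j) (R k l)) : False := by
  choose γ hγ using hγ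
  obtain ⟨n, hn⟩ := exists_winding_numbers (fun i : Fin 5 => (i : ℕ)) Fin.val_injective z hz
    (· < ·) γ (fun i j k l h h' h1 h2 h3 h4 => (hR i j k l h h' h1 h2 h3 h4).mono
      (hγ i j h) (hγ k l h'))
  simp only [orderSign] at hn
  -- These are all 15 pairs of independent edges. In the sum of the halved relations each winding
  -- number occurs twice up to sign, so the left side is even. The right side counts the interleaved
  -- pairs, of which there are 5.
  have h1 := hn 0 1 2 3 (by decide) (by decide) (by decide) (by decide) (by decide) (by decide)
  have h2 := hn 0 2 1 3 (by decide) (by decide) (by decide) (by decide) (by decide) (by decide)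
  have h3 := hn 0 3 1 2 (by decide) (by decide) (by decide) (by decide) (by decide) (by decide)
  have h4 := hn 0 1 2 4 (by decide) (by decide) (by decide) (by decide) (by decide) (by decide)
  have h5 := hn 0 2 1 4 (by decide) (by decide) (by decide) (by decide) (by decide) (by decide)
  have h6 := hn 0 4 1 2 (by decide) (by decide) (by decide) (by decide) (by decide) (by decide)
  have h7 := hn 0 1 3 4 (by decide) (by decide) (by decide) (by decide) (by decide) (by decide)
  have h8 := hn 0 3 1 4 (by decide) (by decide) (by decide) (by decide) (by decide) (by decide)
  have h9 := hn 0 4 1 3 (by decide) (by decide) (by decide) (by decide) (by decide) (by decide)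
  have ha := hn 0 2 3 4 (by decide) (by decide) (by decide) (by decide) (by decide) (by decide)
  have hb := hn 0 3 2 4 (by decide) (by decide) (by decide) (by decide) (by decide) (by decide)
  have hc := hn 0 4 2 3 (by decide) (by decide) (by decide) (by decide) (by decide) (by decide)
  have hd := hn 1 2 3 4 (by decide) (by decide) (by decide) (by decide) (by decide) (by decide)
  have he := hn 1 3 2 4 (by decide) (by decide) (by decide) (by decide) (by decide) (by decide)
  have hf := hn 1 4 2 3 (by decide) (by decide) (by decide) (by decide) (by decide) (by decide)
  simp +decide at h1 h2 h3 h4 h5 h6 h7 h8 h9 ha hb hc hd he hf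
  omega

/-- `K₃,₃` has no drawing in which independent edges are disjoint. -/
theorem not_exists_K33_drawing (s t : Fin 3 → ℂ) (hs : Function.Injective s)
    (ht : Function.Injective t) (hst : ∀ i j, s i ≠ t j) (R : Fin 3 → Fin 3 → Set ℂ)
    (hγ : ∀ i j, ∃ γ : Path (s i) (t j), Set.range γ ⊆ R i j)
    (hR : ∀ i j k l, i ≠ k → j ≠ l → Disjoint (R i j) (R k l)) : False := by
  choose γ hγ using hγ
  let E : Fin 3 ⊕ Fin 3 → Fin 3 ⊕ Fin 3 → Prop := fun a b => a.isLeft ∧ b.isRight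
  let γ' : ∀ a b, E a b → Path (Sum.elim s t a) (Sum.elim s t b)
    | .inl i, .inr j, _ => γ i j
    | .inl i, .inl j, h => absurd h.2 (by simp)
    | .inr i, _, h => absurd h.1 (by simp)
  obtain ⟨n, hn⟩ := exists_winding_numbers
    (Sum.elim (fun i : Fin 3 => (i : ℕ)) (fun i : Fin 3 => (i : ℕ) + 3))
    (by decide) (Sum.elim s t) (hs.sumElim ht hst) E γ' (by
      rintro (i | i) (j | j) (k | k) (l | l) h h' h1 h2 h3 h4 <;>
        first | exact (Bool.false_ne_true h.1).elim | exact (Bool.false_ne_true h.2).elim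
              | exact (Bool.false_ne_true h'.1).elim | exact (Bool.false_ne_true h'.2).elim | skip
      exact (hR i j k l (by simpa using h1) (by simpa using h4)).mono (hγ i j) (hγ k l))
  have hn' : ∀ i j k l : Fin 3, i < k → j ≠ l →
      n (.inl i) (.inr j) (.inr l) - n (.inl i) (.inr j) (.inl k) - n (.inl k) (.inr l) (.inr j) +
        n (.inl k) (.inr l) (.inl i) = if j < l then 1 else 0 := by
    intro i j k l hik hjl
    have := hn (.inl i) (.inr j) (.inl k) (.inr l) (by simp [E]) (by simp [E])
      (by simpa using hik.ne) (by simp) (by simp) (by simpa using hjl)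
    have e1 : (i : ℕ) < l + 3 := by omega
    have e2 : ¬ (j : ℕ) + 3 < k := by omega
    simp only [orderSign, Sum.elim_inl, Sum.elim_inr, Fin.val_fin_lt.2 hik, e1, e2,
      add_lt_add_iff_right, if_true, if_false, Fin.val_fin_lt] at this
    split_ifs at this ⊢ <;> omega
  -- All 18 pairs of independent edges. Again each integer occurs twice up to sign in the total,
  -- whereas the right sides add up to 9.
  have A := fun i k (h : i < k) => And.intro (hn' i 0 k 1 h (by decide)) <|
    And.intro (hn' i 1 k 0 h (by decide)) <| And.intro (hn' i 0 k 2 h (by decide)) <|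
    And.intro (hn' i 2 k 0 h (by decide)) <| And.intro (hn' i 1 k 2 h (by decide))
    (hn' i 2 k 1 h (by decide))
  have h1 := A 0 1 (by decide)
  have h2 := A 0 2 (by decide)
  have h3 := A 1 2 (by decide)
  simp +decide only [if_true, if_false] at h1 h2 h3
  omega

/-! ### Connected vertex sets and the two forbidden configurations -/

namespace SimpleGraph

variable {V : Type*} {G : SimpleGraph V}

/-- `x` and `y` are joined by a walk inside `S`. -/
def Linked (G : SimpleGraph V) (S : Set V) (x y : V) : Prop :=
  ∃ p : G.Walk x y, ∀ z ∈ p.support, z ∈ S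

/-- `S` is nonempty and induces a connected subgraph. -/
def ConnSet (G : SimpleGraph V) (S : Set V) : Prop :=
  S.Nonempty ∧ ∀ x ∈ S, ∀ y ∈ S, G.Linked S x y

theorem Linked.refl {S : Set V} {x : V} (hx : x ∈ S) : G.Linked S x x :=
  ⟨.nil, by simpa using hx⟩

theorem Linked.symm {S : Set V} {x y : V} (h : G.Linked S x y) : G.Linked S y x := by
  obtain ⟨p, hp⟩ := h
  exact ⟨p.reverse, by simpa using hp⟩

theorem Linked.trans {S : Set V} {x y z : V} (h : G.Linked S x y) (h' : G.Linked S y z) :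
    G.Linked S x z := by
  obtain ⟨p, hp⟩ := h
  obtain ⟨q, hq⟩ := h'
  refine ⟨p.append q, fun w hw => ?_⟩
  rcases (Walk.mem_support_append_iff _ _).1 hw with hw | hw
  exacts [hp _ hw, hq _ hw]

theorem Linked.mono {S T : Set V} {x y : V} (hST : S ⊆ T) (h : G.Linked S x y) :
    G.Linked T x y := by
  obtain ⟨p, hp⟩ := h
  exact ⟨p, fun z hz => hST (hp z hz)⟩

theorem Adj.linked {S : Set V} {x y : V} (h : G.Adj x y) (hx : x ∈ S) (hy : y ∈ S) :
    G.Linked S x y := ⟨h.toWalk, by simp [hx, hy]⟩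

theorem Linked.left_mem {S : Set V} {x y : V} (h : G.Linked S x y) : x ∈ S := by
  obtain ⟨p, hp⟩ := h
  exact hp _ p.start_mem_support

theorem Linked.right_mem {S : Set V} {x y : V} (h : G.Linked S x y) : y ∈ S :=
  h.symm.left_mem

theorem connSet_singleton (x : V) : G.ConnSet {x} :=
  ⟨⟨x, rfl⟩, by rintro _ rfl _ rfl; exact .refl rfl⟩

theorem ConnSet.union {S T : Set V} (hS : G.ConnSet S) (hT : G.ConnSet T) {x y : V}
    (hx : x ∈ S) (hy : y ∈ T) (h : G.Adj x y ∨ x = y) : G.ConnSet (S ∪ T) := by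
  have key : ∀ z ∈ S ∪ T, G.Linked (S ∪ T) z x := by
    rintro z (hz | hz)
    · exact (hS.2 z hz x hx).mono Set.subset_union_left
    · refine ((hT.2 z hz y hy).mono Set.subset_union_right).trans ?_
      rcases h with h | rfl
      · exact h.symm.linked (.inr hy) (.inl hx)
      · exact .refl (.inl hx)
  exact ⟨⟨x, .inl hx⟩, fun a ha b hb => (key a ha).trans (key b hb).symm⟩

/-- `G` contains no two vertices joined by three disjoint connected sets of further vertices. -/
def ThetaFree (G : SimpleGraph V) : Prop :=
  ∀ (p q : V) (A : Fin 3 → Set V), p ≠ q → (∀ i, G.ConnSet (A i)) →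
    (∀ i j, i ≠ j → Disjoint (A i) (A j)) → (∀ i, p ∉ A i) → (∀ i, q ∉ A i) →
    (∀ i, ∃ x ∈ A i, G.Adj p x) → (∀ i, ∃ x ∈ A i, G.Adj q x) → False

/-- `G` contains no two adjacent vertices `u`, `v` and two adjacent disjoint connected sets of
further vertices that are adjacent to both `u` and `v`. -/
def EdgeK4Free (G : SimpleGraph V) : Prop :=
  ∀ (u v : V) (A B : Set V), G.Adj u v → G.ConnSet A → G.ConnSet B → Disjoint A B →
    u ∉ A → v ∉ A → u ∉ B → v ∉ B → (∃ x ∈ A, G.Adj u x) → (∃ x ∈ A, G.Adj v x) →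
    (∃ x ∈ B, G.Adj u x) → (∃ x ∈ B, G.Adj v x) → (∃ x ∈ A, ∃ y ∈ B, G.Adj x y) → False

end SimpleGraph

/-! ### Topology of plane drawings -/

namespace PlaneDrawing

variable {V : Type*} {G : SimpleGraph V} (D : PlaneDrawing G)

/-- The drawing of the subgraph induced by `S`. -/
def image (S : Set V) : Set Plane :=
  D.pos '' S ∪ {p | ∃ (u v : V) (h : G.Adj u v), u ∈ S ∧ v ∈ S ∧ p ∈ Set.range (D.arc h)}

theorem image_mono {S T : Set V} (h : S ⊆ T) : D.image S ⊆ D.image T := by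
  rintro p (hp | ⟨u, v, huv, hu, hv, hp⟩)
  · exact .inl (Set.image_mono h hp)
  · exact .inr ⟨u, v, huv, h hu, h hv, hp⟩

theorem image_subset_support (S : Set V) : D.image S ⊆ D.support := by
  rintro p (⟨x, -, rfl⟩ | ⟨u, v, huv, hu, hv, hp⟩)
  · exact .inl ⟨x, rfl⟩
  · exact .inr ⟨u, v, huv, hp⟩

theorem image_univ : D.image Set.univ = D.support := by
  simp [image, support]

theorem isClosed_image [Finite V] (S : Set V) : IsClosed (D.image S) := by
  have : {p | ∃ (u v : V) (h : G.Adj u v), u ∈ S ∧ v ∈ S ∧ p ∈ Set.range (D.arc h)} =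
      ⋃ (u : V) (v : V) (h : G.Adj u v) (_ : u ∈ S ∧ v ∈ S), Set.range (D.arc h) := by
    ext p; simp only [Set.mem_ofPred_eq, Set.mem_iUnion, exists_prop, and_assoc]
  rw [image, this]
  refine (Set.toFinite _).isClosed.union ?_
  refine isClosed_iUnion_of_finite fun u => isClosed_iUnion_of_finite fun v =>
    isClosed_iUnion_of_finite fun h => isClosed_iUnion_of_finite fun _ =>
    (isCompact_range (D.arc h).continuous).isClosed

theorem pos_notMem_image {S : Set V} {a : V} (ha : a ∉ S) : D.pos a ∉ D.image S := by
  rintro (⟨x, hx, e⟩ | ⟨u, v, h, hu, hv, hp⟩)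
  · exact ha (D.pos_injective e ▸ hx)
  · rcases D.vertex_on_arc h hp with rfl | rfl
    exacts [ha hu, ha hv]

theorem disjoint_image {S T : Set V} (h : Disjoint S T) : Disjoint (D.image S) (D.image T) := by
  rw [Set.disjoint_left] at h ⊢
  rintro p (⟨x, hx, rfl⟩ | ⟨u, v, huv, hu, hv, hp⟩) hpT
  · exact D.pos_notMem_image (h hx) hpT
  · rcases hpT with ⟨x, hx, rfl⟩ | ⟨u', v', huv', hu', hv', hp'⟩
    · exact D.pos_notMem_image (fun hxS => h hxS hx) (.inr ⟨u, v, huv, hu, hv, hp⟩)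
    · have hne : s(u, v) ≠ s(u', v') := by
        intro e
        rcases Sym2.eq_iff.1 e with ⟨rfl, rfl⟩ | ⟨rfl, rfl⟩
        exacts [h hu hu', h hu hv']
      obtain ⟨w, hw, hw', -⟩ := D.arc_inter_arc huv huv' hne p ⟨hp, hp'⟩
      rcases Sym2.mem_iff.1 hw with rfl | rfl <;> rcases Sym2.mem_iff.1 hw' with rfl | rfl
      exacts [h hu hu', h hu hv', h hv hu', h hv hv']

theorem exists_path_of_walk {S : Set V} {a b : V} (p : G.Walk a b) (hp : ∀ z ∈ p.support, z ∈ S) :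
    ∃ γ : Path (D.pos a) (D.pos b), Set.range γ ⊆ D.image S := by
  induction p with
  | nil =>
    refine ⟨Path.refl _, ?_⟩
    rintro _ ⟨t, rfl⟩
    exact .inl ⟨_, hp _ (by simp), rfl⟩
  | @cons u v w h p ih =>
    obtain ⟨γ, hγ⟩ := ih (fun z hz => hp z (by simp [hz]))
    refine ⟨(D.arc h).trans γ, ?_⟩
    rw [Path.trans_range]
    refine Set.union_subset (fun x hx => .inr ⟨u, v, h, hp _ (by simp), hp _ (by simp), hx⟩) hγ

theorem exists_path_of_linked {S : Set V} {a b : V} (h : G.Linked S a b) :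
    ∃ γ : Path (D.pos a) (D.pos b), Set.range γ ⊆ D.image S := by
  obtain ⟨p, hp⟩ := h
  exact D.exists_path_of_walk p hp

/-- A point of the external face can be joined to every vertex. -/
theorem exists_apex [Finite V] {F : Set Plane} (hF : D.IsFace F)
    (hv : ∀ v, D.pos v ∈ frontier F) :
    ∃ x ∉ D.support, ∀ a, ∃ γ : Path x (D.pos a), Disjoint (Set.range γ) (D.image {a}ᶜ) := by
  obtain ⟨x, hx, rfl⟩ := hF
  have hopen : IsOpen D.supportᶜ := by
    rw [← D.image_univ]
    exact (D.isClosed_image _).isOpen_compl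
  have hsub := connectedComponentIn_subset D.supportᶜ x
  have hpc : IsPathConnected (connectedComponentIn D.supportᶜ x) :=
    hopen.connectedComponentIn.isConnected_iff_isPathConnected.1
      (isConnected_connectedComponentIn_iff.2 hx)
  refine ⟨x, hx, fun a => ?_⟩
  -- The curve stays in the face until it is within `ε` of `a`, then runs inside a ball that misses
  -- everything drawn on the other vertices.
  obtain ⟨ε, hε, hball⟩ := Metric.isOpen_iff.1 (D.isClosed_image {a}ᶜ).isOpen_compl (D.pos a)
    (D.pos_notMem_image (by simp))
  obtain ⟨y, hy, hya⟩ := Metric.mem_closure_iff.1 (frontier_subset_closure (hv a)) ε hε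
  have h1 := hpc.joinedIn x (mem_connectedComponentIn hx) y hy
  have h2 := ((convex_ball (D.pos a) ε).isPathConnected ⟨_, Metric.mem_ball_self hε⟩).joinedIn y
    (Metric.mem_ball'.2 hya) (D.pos a) (Metric.mem_ball_self hε)
  have h3 := (h1.mono (Set.subset_union_left (t := Metric.ball (D.pos a) ε))).trans
    (h2.mono Set.subset_union_right)
  refine ⟨h3.somePath, Set.disjoint_left.2 ?_⟩
  rintro _ ⟨t, rfl⟩ ht
  rcases h3.somePath_mem t with h | h
  · exact hsub h (D.image_subset_support _ ht)
  · exact hball h ht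

end PlaneDrawing

/-! ### Forbidden configurations in outerplanar graphs -/

namespace SimpleGraph

variable {V : Type*} {G : SimpleGraph V}

theorem IsOuterplanar.exists_apex [Finite V] (h : G.IsOuterplanar) :
    ∃ (D : PlaneDrawing G) (x : Plane), x ∉ D.support ∧
      ∀ a, ∃ γ : _root_.Path x (D.pos a), Disjoint (Set.range γ) (D.image {a}ᶜ) := by
  obtain ⟨D, F, hF, hv⟩ := h
  obtain ⟨x, hx, h⟩ := D.exists_apex hF.1 hv
  exact ⟨D, x, hx, h⟩

/-- The vertices `p`, `q` and the apex form one side of a K₃,₃; the other side consists of one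
representative of each `A i`, reached from `p` and `q` through `A i`. -/
theorem IsOuterplanar.thetaFree [Finite V] (h : G.IsOuterplanar) : G.ThetaFree := by
  intro p q A hpq hA hdis hp hq hpA hqA
  obtain ⟨D, x, hx, hγ⟩ := h.exists_apex
  choose γ hγ using hγ
  choose a ha hpa using hpA
  choose b hb hqb using hqA
  let φ := Complex.orthonormalBasisOneI.repr.symm
  have hφ : Continuous φ := φ.continuous
  have hpos : ∀ v, D.pos v ≠ x := fun v e => hx (e ▸ .inl ⟨v, rfl⟩)
  let R : Fin 3 → Fin 3 → Set Plane := fun i j =>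
    if i = 0 then D.image (insert p (A j)) else if i = 1 then D.image (insert q (A j)) else
      Set.range (γ (a j))
  let s : Fin 3 → Plane := ![D.pos p, D.pos q, x]
  have hR : ∀ i j, ∃ γ : _root_.Path (s i) (D.pos (a j)), Set.range γ ⊆ R i j := by
    intro i j
    fin_cases i
    · exact D.exists_path_of_linked ((hpa j).linked (Set.mem_insert _ _) (.inr (ha j)))
    · exact D.exists_path_of_linked (((hqb j).linked (Set.mem_insert _ _) (.inr (hb j))).trans
        (((hA j).2 _ (hb j) _ (ha j)).mono (Set.subset_insert _ _)))
    · exact ⟨γ (a j), subset_rfl⟩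
  have key : ∀ j l, j ≠ l → Disjoint (insert p (A j)) (insert q (A l)) := by
    intro j l hjl
    rw [Set.disjoint_insert_left, Set.disjoint_insert_right]
    exact ⟨by simp [hpq, hp], hq j, hdis j l hjl⟩
  have key2 : ∀ j l, j ≠ l → ∀ w, w ∉ A j → insert w (A l) ⊆ {a j}ᶜ := by
    rintro j l hjl w hw y hy rfl
    rcases hy with hy | hy
    · exact hw (hy ▸ ha j)
    · exact Set.disjoint_left.1 (hdis j l hjl) (ha j) hy
  have hdisj : ∀ i j k l, i < k → j ≠ l → Disjoint (R i j) (R k l) := by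
    intro i j k l hik hjl
    fin_cases i <;> fin_cases k <;> first | exact absurd hik (by decide) | skip
    · exact D.disjoint_image (key j l hjl)
    · exact ((hγ (a l)).mono_right (D.image_mono (key2 l j hjl.symm p (hp l)))).symm
    · exact ((hγ (a l)).mono_right (D.image_mono (key2 l j hjl.symm q (hq l)))).symm
  refine not_exists_K33_drawing (fun i => φ (s i)) (fun j => φ (D.pos (a j)))
    (φ.injective.comp ?_) (φ.injective.comp (D.pos_injective.comp ?_)) (fun i j e => ?_)
    (fun i j => φ '' R i j) (fun i j => ?_) (fun i j k l hik hjl => ?_)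
  · intro i j
    fin_cases i <;> fin_cases j <;>
      simp [s, D.pos_injective.eq_iff, hpq, hpq.symm, hpos, (hpos _).symm]
  · intro i j hij
    by_contra hne
    exact Set.disjoint_left.1 (hdis i j hne) (ha i) (hij ▸ ha j)
  · have := φ.injective e
    fin_cases i
    · exact hp j (D.pos_injective this ▸ ha j)
    · exact hq j (D.pos_injective this ▸ ha j)
    · exact hpos _ this.symm
  · obtain ⟨δ, hδ⟩ := hR i j
    refine ⟨δ.map hφ, ?_⟩
    rintro _ ⟨t, rfl⟩
    exact ⟨_, hδ ⟨t, rfl⟩, rfl⟩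
  · refine (Set.disjoint_image_iff φ.injective).2 ?_
    rcases lt_or_gt_of_ne hik with h | h
    · exact hdisj i j k l h hjl
    · exact (hdisj k l i j h hjl.symm).symm

/-- `u`, `v`, representatives of `A` and `B`, and the apex (index `4`) are the five vertices of a
K₅. -/
theorem IsOuterplanar.edgeK4Free [Finite V] (h : G.IsOuterplanar) : G.EdgeK4Free := by
  intro u v A B huv hA hB hAB huA hvA huB hvB hAu hAv hBu hBv hadj
  obtain ⟨D, x, hx, hγ⟩ := h.exists_apex
  choose γ hγ using hγ
  obtain ⟨a0, ha0⟩ := hA.1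
  obtain ⟨b0, hb0⟩ := hB.1
  let φ := Complex.orthonormalBasisOneI.repr.symm
  have hφ : Continuous φ := φ.continuous
  have hpos : ∀ v, D.pos v ≠ x := fun v e => hx (e ▸ .inl ⟨v, rfl⟩)
  let S : Fin 5 → Set V := ![{u}, {v}, A, B, ∅]
  let c : Fin 5 → V := ![u, v, a0, b0, u]
  let z : Fin 5 → Plane := fun i => if i = 4 then x else D.pos (c i)
  let R : Fin 5 → Fin 5 → Set Plane := fun i j =>
    if j = 4 then Set.range (γ (c i)) else D.image (S i ∪ S j)
  have hc : ∀ i, i ≠ 4 → c i ∈ S i := by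
    intro i hi
    fin_cases i <;> simp_all [c, S]
  have hS : ∀ i, i ≠ 4 → G.ConnSet (S i) := by
    intro i hi
    fin_cases i
    exacts [connSet_singleton _, connSet_singleton _, hA, hB, absurd rfl hi]
  have hlink : ∀ i j, i < j → j ≠ 4 → ∃ y ∈ S i, ∃ w ∈ S j, G.Adj y w := by
    intro i j hij hj
    fin_cases i <;> fin_cases j <;>
      first | exact absurd hij (by decide) | exact absurd rfl hj | skip
    · exact ⟨u, rfl, v, rfl, huv⟩
    · exact ⟨u, rfl, hAu⟩
    · exact ⟨u, rfl, hBu⟩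
    · exact ⟨v, rfl, hAv⟩
    · exact ⟨v, rfl, hBv⟩
    · exact hadj
  have hdS' : ∀ i j, i < j → Disjoint (S i) (S j) := by
    intro i j hij
    fin_cases i <;> fin_cases j <;>
      first | exact absurd hij (by decide) | simp [S, *]
    exact huv.ne
  have hdS : ∀ i j, i ≠ j → Disjoint (S i) (S j) := by
    intro i j hij
    rcases lt_or_gt_of_ne hij with h | h
    exacts [hdS' i j h, (hdS' j i h).symm]
  have hR : ∀ i j, i < j → ∃ γ : _root_.Path (z i) (z j), Set.range γ ⊆ R i j := by
    intro i j hij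
    have hi : i ≠ 4 := by omega
    by_cases hj : j = 4
    · subst hj
      have e1 : z i = D.pos (c i) := if_neg hi
      have e2 : z 4 = x := rfl
      rw [e1, e2]
      refine ⟨(γ (c i)).symm, ?_⟩
      rw [_root_.Path.symm_range]
      exact subset_rfl
    · have e1 : z i = D.pos (c i) := if_neg hi
      have e2 : z j = D.pos (c j) := if_neg hj
      rw [e1, e2]
      simp only [R, if_neg hj]
      obtain ⟨y, hy, w, hw, hyw⟩ := hlink i j hij hj
      exact D.exists_path_of_linked (((hS i hi).union (hS j hj) hy hw (.inl hyw)).2 _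
        (.inl (hc i hi)) _ (.inr (hc j hj)))
  have hdisj : ∀ i j k l, i < j → k < l → i ≠ k → i ≠ l → j ≠ k → l ≠ 4 →
      j ≠ l → Disjoint (R i j) (R k l) := by
    intro i j k l hij hkl hik hil hjk hl hjl
    by_cases hj : j = 4
    · simp only [R, if_neg hl, if_pos hj]
      refine (hγ (c i)).mono_right (D.image_mono ?_)
      have hi : i ≠ 4 := by omega
      rintro y (hy | hy) rfl
      · exact Set.disjoint_left.1 (hdS i k hik) (hc i hi) hy
      · exact Set.disjoint_left.1 (hdS i l hil) (hc i hi) hy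
    · simp only [R, if_neg hl, if_neg hj]
      refine D.disjoint_image ?_
      simp [hdS _ _ hik, hdS _ _ hil, hdS _ _ hjk, hdS _ _ hjl]
  refine not_exists_K5_drawing (fun i => φ (z i)) (φ.injective.comp ?_) (fun i j => φ '' R i j)
    (fun i j hij => ?_) (fun i j k l hij hkl hik hil hjk hjl => ?_)
  · intro i j hij
    simp only [z] at hij
    split_ifs at hij with h1 h2 h2
    · rw [h1, h2]
    · exact absurd hij.symm (hpos _)
    · exact absurd hij (hpos _)
    · by_contra hne
      exact Set.disjoint_left.1 (hdS i j hne) (hc i h1) (D.pos_injective hij ▸ hc j h2)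
  · obtain ⟨δ, hδ⟩ := hR i j hij
    refine ⟨δ.map hφ, ?_⟩
    rintro _ ⟨t, rfl⟩
    exact ⟨_, hδ ⟨t, rfl⟩, rfl⟩
  · refine (Set.disjoint_image_iff φ.injective).2 ?_
    by_cases hl : l = 4
    · exact (hdisj k l i j hkl hij hik.symm hjk.symm hil.symm (hl ▸ hjl) hjl.symm).symm
    · exact hdisj i j k l hij hkl hik hil hjk hl hjl

end SimpleGraph

namespace SimpleGraph

variable {V : Type*} {G : SimpleGraph V}

/-! ### Components of vertex sets -/

/-- The vertices that are joined to `x` by a walk inside `S`. -/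
def compIn (G : SimpleGraph V) (S : Set V) (x : V) : Set V := {y | G.Linked S x y}

theorem compIn_subset {S : Set V} {x : V} : G.compIn S x ⊆ S := fun _ h => h.right_mem

theorem mem_compIn_self {S : Set V} {x : V} (hx : x ∈ S) : x ∈ G.compIn S x := .refl hx

theorem mem_compIn_of_adj {S : Set V} {x y z : V} (hy : y ∈ G.compIn S x) (h : G.Adj y z)
    (hz : z ∈ S) : z ∈ G.compIn S x :=
  Linked.trans hy (h.linked hy.right_mem hz)

theorem Linked.compIn {S : Set V} {x y : V} (h : G.Linked S x y) :
    G.Linked (G.compIn S x) x y := by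
  classical
  obtain ⟨p, hp⟩ := h
  refine ⟨p, fun z hz => ⟨p.takeUntil z hz, fun w hw => hp w ?_⟩⟩
  exact p.support_takeUntil_subset_support hz hw

theorem connSet_compIn {S : Set V} {x : V} (hx : x ∈ S) : G.ConnSet (G.compIn S x) :=
  ⟨⟨x, mem_compIn_self hx⟩, fun _ ha _ hb => ha.compIn.symm.trans hb.compIn⟩

theorem disjoint_compIn {S : Set V} {x y : V} (h : y ∉ G.compIn S x) :
    Disjoint (G.compIn S x) (G.compIn S y) :=
  Set.disjoint_left.2 fun _ h1 h2 => h (Linked.trans h1 (Linked.symm h2))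

/-- A walk that leaves a set does so along an edge. -/
theorem Linked.exists_adj_boundary {S C : Set V} {x y : V} (h : G.Linked S x y) (hx : x ∈ C)
    (hy : y ∉ C) : ∃ a ∈ C, ∃ b ∉ C, a ∈ S ∧ b ∈ S ∧ G.Adj a b := by
  obtain ⟨p, hp⟩ := h
  induction p with
  | nil => exact absurd hx hy
  | @cons u v w h p ih =>
    by_cases hv : v ∈ C
    · exact ih hv hy (fun z hz => hp z (by simp [hz]))
    · exact ⟨u, hx, v, hv, hp _ (by simp), hp _ (by simp), h⟩

theorem Linked.reachable {S : Set V} {x y : V} {K : SimpleGraph V} (h : G.Linked S x y)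
    (hK : ∀ a ∈ S, ∀ b ∈ S, G.Adj a b → K.Adj a b) : K.Reachable x y := by
  obtain ⟨p, hp⟩ := h
  induction p with
  | nil => exact .refl _
  | @cons u v w h p ih =>
    exact (hK _ (hp _ (by simp)) _ (hp _ (by simp)) h).reachable.trans
      (ih (fun z hz => hp z (by simp [hz])))

/-! ### Induced paths as lists -/

/-- The list `l` runs through the vertices of an induced path of `G`. -/
def IsIndList (G : SimpleGraph V) : List V → Prop
  | [] => True
  | [_] => True
  | a :: b :: l => G.Adj a b ∧ (∀ x ∈ l, ¬ G.Adj a x) ∧ a ∉ b :: l ∧ IsIndList G (b :: l)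

theorem IsIndList.tail {a : V} {l : List V} (h : G.IsIndList (a :: l)) : G.IsIndList l := by
  cases l with
  | nil => trivial
  | cons b l => exact h.2.2.2

theorem IsIndList.nodup {l : List V} (h : G.IsIndList l) : l.Nodup := by
  induction l with
  | nil => simp
  | cons a l ih =>
    refine List.nodup_cons.2 ⟨?_, ih h.tail⟩
    cases l with
    | nil => simp
    | cons b l => exact h.2.2.1

theorem IsIndList.adj_iff {l : List V} (h : G.IsIndList l) :
    ∀ (i j : ℕ) (hi : i < l.length) (hj : j < l.length), i < j →
      (G.Adj l[i] l[j] ↔ i + 1 = j) := by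
  induction l with
  | nil => intro i j hi; simp at hi
  | cons a l ih =>
    intro i j hi hj hij
    obtain ⟨j, rfl⟩ : ∃ k, j = k + 1 := ⟨j - 1, by omega⟩
    cases i with
    | succ i =>
      have := ih h.tail i j (by simpa using hi) (by simpa using hj) (by omega)
      simpa using this
    | zero =>
      cases l with
      | nil => simp at hj
      | cons b l =>
        cases j with
        | zero => simpa using h.1
        | succ j => simpa using h.2.1 _ (List.getElem_mem _)

theorem IsIndList.hasInducedPath {l : List V} (h : G.IsIndList l) : G.HasInducedPath l.length := by
  have hinj : Function.Injective fun i : Fin l.length => l[i.1] := fun i j hij =>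
    Fin.ext ((h.nodup.getElem_inj_iff).1 hij)
  have hadj : ∀ i j : Fin l.length, G.Adj l[i.1] l[j.1] ↔ i.1 + 1 = j.1 ∨ j.1 + 1 = i.1 := by
    intro i j
    rcases lt_trichotomy i.1 j.1 with hij | hij | hij
    · rw [h.adj_iff i j i.2 j.2 hij]; omega
    · obtain rfl : i = j := Fin.ext hij
      simp
    · rw [G.adj_comm, h.adj_iff j i j.2 i.2 hij]; omega
  exact ⟨⟨⟨_, hinj⟩, fun {i j} => (hadj i j).trans pathGraph_adj.symm⟩⟩

/-- Used to glue a path segment `g 0, …, g i` to an induced path that starts at `g i`; only `g i`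
may have neighbours in the rest `T`. -/
theorem IsIndList.prepend_path {T : List V} (i : ℕ) : ∀ (g : ℕ → V), G.IsIndList (g i :: T) →
    (∀ a b, a < b → b ≤ i → g a ≠ g b ∧ (G.Adj (g a) (g b) ↔ b = a + 1)) →
    (∀ a < i, ∀ y ∈ T, ¬ G.Adj (g a) y ∧ g a ≠ y) →
    ∃ L : List V, L.length = i + T.length ∧ G.IsIndList (g 0 :: L) ∧
      ∀ x ∈ L, x ∈ T ∨ ∃ a, 0 < a ∧ a ≤ i ∧ x = g a := by
  induction i with
  | zero => exact fun g hT _ _ => ⟨T, by simp, hT, fun x hx => .inl hx⟩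
  | succ i ih =>
    intro g hT hg hgT
    obtain ⟨L, hL, hL', hLT⟩ := ih (fun a => g (a + 1)) hT
      (fun a b hab hb => ⟨(hg _ _ (by omega) (by omega)).1,
        (hg _ _ (by omega) (by omega)).2.trans (by omega)⟩)
      (fun a ha => hgT (a + 1) (by omega))
    refine ⟨g 1 :: L, by simp [hL]; omega, ⟨?_, ?_, ?_, hL'⟩, ?_⟩
    · exact ((hg 0 1 (by omega) (by omega)).2).2 rfl
    · intro x hx
      rcases hLT x hx with h | ⟨a, ha, hai, rfl⟩
      · exact (hgT 0 (by omega) x h).1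
      · rw [(hg 0 (a + 1) (by omega) (by omega)).2]; omega
    · intro hx
      rcases List.mem_cons.1 hx with h | hx
      · exact (hg 0 1 (by omega) (by omega)).1 h
      · rcases hLT _ hx with h | ⟨a, ha, hai, h⟩
        · exact (hgT 0 (by omega) _ h).2 rfl
        · exact (hg 0 (a + 1) (by omega) (by omega)).1 h
    · intro x hx
      rcases List.mem_cons.1 hx with rfl | hx
      · exact .inr ⟨1, by omega, by omega, rfl⟩
      · rcases hLT _ hx with h | ⟨a, ha, hai, rfl⟩
        · exact .inl h
        · exact .inr ⟨a + 1, by omega, by omega, rfl⟩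

theorem Reachable.exists_shortest {u v : V} (h : G.Reachable u v) :
    ∃ (r : ℕ) (f : ℕ → V), f 0 = u ∧ f r = v ∧ (∀ i < r, G.Adj (f i) (f (i + 1))) ∧
      (∀ i j, i < j → j ≤ r → f i ≠ f j) ∧
      (∀ i j, i < j → j ≤ r → G.Adj (f i) (f j) → j = i + 1) := by
  obtain ⟨p, hp⟩ := h.exists_walk_length_eq_dist
  refine ⟨p.length, p.getVert, p.getVert_zero, p.getVert_length,
    fun i hi => p.adj_getVert_succ hi, fun i j hij hj e => ?_, fun i j hij hj hadj => ?_⟩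
  · have := G.dist_le ((p.take i).append ((p.drop j).copy e.symm rfl))
    simp only [Walk.length_append, Walk.length_copy, Walk.take_length, Walk.drop_length] at this
    omega
  · have := G.dist_le ((p.take i).append (.cons hadj (p.drop j)))
    simp only [Walk.length_append, Walk.length_cons, Walk.take_length, Walk.drop_length] at this
    omega

/-! ### Detours around an edge -/

/-- `f` runs through the vertices of a path from `u` to `v` with interior in `D` that is induced
except possibly for the edge `uv`. -/
structure IsDetour (G : SimpleGraph V) (D : Set V) (u v : V) (r : ℕ) (f : ℕ → V) : Prop where
  two_le : 2 ≤ r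
  start : f 0 = u
  finish : f r = v
  mem : ∀ i, 0 < i → i < r → f i ∈ D
  adj : ∀ i < r, G.Adj (f i) (f (i + 1))
  ne : ∀ i j, i < j → j ≤ r → f i ≠ f j
  eq_succ : ∀ i j, i < j → j ≤ r → G.Adj (f i) (f j) → j = i + 1 ∨ (i = 0 ∧ j = r)

/-- Take a shortest path in the graph `K` induced on `D ∪ {u, v}` with the edge `uv` deleted.
Deleting it forces the path through `D`, and it is the only chord that can remain. -/
theorem exists_isDetour {D : Set V} {u v : V} (huv : u ≠ v) (hu : u ∉ D) (hv : v ∉ D)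
    (hD : G.ConnSet D) (hDu : ∃ x ∈ D, G.Adj u x) (hDv : ∃ x ∈ D, G.Adj v x) :
    ∃ r f, G.IsDetour D u v r f := by
  obtain ⟨x, hx, hux⟩ := hDu
  obtain ⟨y, hy, hvy⟩ := hDv
  let K : SimpleGraph V :=
    { Adj := fun a b => G.Adj a b ∧ a ∈ insert u (insert v D) ∧ b ∈ insert u (insert v D) ∧
        s(a, b) ≠ s(u, v)
      symm := ⟨fun a b h => ⟨h.1.symm, h.2.2.1, h.2.1, by rw [Sym2.eq_swap]; exact h.2.2.2⟩⟩
      loopless := ⟨fun a h => h.1.ne rfl⟩ }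
  have hDK : ∀ a b, b ∈ D → G.Adj a b → a ∈ insert u (insert v D) → K.Adj a b := by
    refine fun a b hb hab ha => ⟨hab, ha, .inr (.inr hb), fun e => ?_⟩
    rcases Sym2.eq_iff.1 e with ⟨-, rfl⟩ | ⟨-, rfl⟩
    exacts [hv hb, hu hb]
  have hr : K.Reachable u v := by
    refine (hDK u x hx hux (.inl rfl)).reachable.trans (.trans ?_
      (hDK v y hy hvy (.inr (.inl rfl))).symm.reachable)
    exact (hD.2 x hx y hy).reachable fun a ha b hb hab => hDK a b hb hab (.inr (.inr ha))
  obtain ⟨r, f, h0, hfr, hadj, hne, hs⟩ := hr.exists_shortest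
  have hr2 : 2 ≤ r := by
    by_contra! hlt
    interval_cases r
    · exact huv (h0.symm.trans hfr)
    · have := (hadj 0 (by omega)).2.2.2
      rw [h0, zero_add, hfr] at this
      exact this rfl
  have hmem : ∀ i ≤ r, f i ∈ insert u (insert v D) := by
    intro i hi
    rcases hi.lt_or_eq with hi | rfl
    · exact (hadj i hi).2.1
    · simp [hfr]
  refine ⟨r, f, hr2, h0, hfr, fun i hi hir => ?_, fun i hi => (hadj i hi).1, hne,
    fun i j hij hj h => ?_⟩
  · rcases hmem i hir.le with h | h | h
    · exact absurd (h0.trans h.symm) (hne 0 i hi hir.le)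
    · exact absurd (h.trans hfr.symm) (hne i r hir le_rfl)
    · exact h
  · by_cases hij' : i = 0 ∧ j = r
    · exact .inr hij'
    · refine .inl (hs i j hij hj ⟨h, hmem i (by omega), hmem j hj, fun e => hij' ?_⟩)
      have key : ∀ k ≤ r, f k = u → k = 0 := fun k hk e => by
        by_contra hk0
        exact hne 0 k (by omega) hk (h0.trans e.symm)
      have key' : ∀ k ≤ r, f k = v → k = r := fun k hk e => by
        by_contra hk0
        exact hne k r (by omega) le_rfl (e.trans hfr.symm)
      rcases Sym2.eq_iff.1 e with ⟨h1, h2⟩ | ⟨h1, h2⟩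
      · exact ⟨key i (by omega) h1, key' j hj h2⟩
      · have := key' i (by omega) h1
        omega

theorem linked_segment {S : Set V} {f : ℕ → V} {a b : ℕ} (hab : a ≤ b)
    (hadj : ∀ i, a ≤ i → i < b → G.Adj (f i) (f (i + 1))) (hS : ∀ i, a ≤ i → i ≤ b → f i ∈ S) :
    G.Linked S (f a) (f b) := by
  induction b, hab using Nat.le_induction with
  | base => exact .refl (hS a le_rfl le_rfl)
  | succ b hab ih =>
    exact (ih (fun i h h' => hadj i h (by omega)) (fun i h h' => hS i h (by omega))).trans
      ((hadj b hab (by omega)).linked (hS b hab (by omega)) (hS _ (by omega) le_rfl))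

namespace IsDetour

variable {D : Set V} {u v : V} {r : ℕ} {f : ℕ → V}

/-- The vertices of a detour. -/
def verts (r : ℕ) (f : ℕ → V) : Set V := {y | ∃ i ≤ r, f i = y}

/-- The part of a detour outside the segment from `f i` to `f j`. -/
def outer (r : ℕ) (f : ℕ → V) (i j : ℕ) : Set V := {y | ∃ k ≤ r, (k < i ∨ j < k) ∧ f k = y}

theorem inj (hf : G.IsDetour D u v r f) {i j : ℕ} (hi : i ≤ r) (hj : j ≤ r) (h : f i = f j) :
    i = j := by
  rcases lt_trichotomy i j with h' | h' | h'
  · exact absurd h (hf.ne i j h' hj)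
  · exact h'
  · exact absurd h.symm (hf.ne j i h' hi)

/-- The edge `uv` closes the detour to a cycle, so the complement of a segment is again one arc. It
is nonempty because the segment is not the whole detour. -/
theorem outer_spec (hf : G.IsDetour D u v r f) (huv : G.Adj u v) {i j : ℕ} (hij : i < j)
    (hj : j ≤ r) (h : ¬ (i = 0 ∧ j = r)) :
    G.ConnSet (outer r f i j) ∧ f i ∉ outer r f i j ∧ f j ∉ outer r f i j ∧
      (∃ x ∈ outer r f i j, G.Adj (f i) x) ∧ (∃ x ∈ outer r f i j, G.Adj (f j) x) := by
  have h0r : G.Adj (f 0) (f r) := by rw [hf.start, hf.finish]; exact huv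
  refine ⟨⟨?_, ?_⟩, ?_, ?_, ?_, ?_⟩
  · by_cases hi : i = 0
    · exact ⟨f r, r, le_rfl, .inr (by omega), rfl⟩
    · exact ⟨f 0, 0, by omega, .inl (by omega), rfl⟩
  · have key1 : ∀ k < i, G.Linked (outer r f i j) (f k) (f 0) := fun k hk =>
      (linked_segment (S := outer r f i j) (Nat.zero_le k) (fun l _ hl => hf.adj l (by omega))
        (fun l _ hl => ⟨l, by omega, .inl (by omega), rfl⟩)).symm
    have key2 : ∀ k, j < k → k ≤ r → G.Linked (outer r f i j) (f k) (f r) := fun k hk hkr =>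
      linked_segment hkr (fun l _ hl => hf.adj l (by omega))
        (fun l hl hlr => ⟨l, by omega, .inr (by omega), rfl⟩)
    rintro _ ⟨k, hkr, hk, rfl⟩ _ ⟨l, hlr, hl, rfl⟩
    rcases hk with hk | hk <;> rcases hl with hl | hl
    · exact (key1 k hk).trans (key1 l hl).symm
    · exact (key1 k hk).trans ((h0r.linked (key1 k hk).right_mem (key2 l hl hlr).right_mem).trans
        (key2 l hl hlr).symm)
    · exact (key2 k hk hkr).trans ((h0r.symm.linked (key2 k hk hkr).right_mem
        (key1 l hl).right_mem).trans (key1 l hl).symm)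
    · exact (key2 k hk hkr).trans (key2 l hl hlr).symm
  · rintro ⟨k, hk, hk', e⟩
    have := hf.inj hk (by omega) e
    omega
  · rintro ⟨k, hk, hk', e⟩
    have := hf.inj hk (by omega) e
    omega
  · by_cases hi : i = 0
    · subst hi
      exact ⟨f r, ⟨r, le_rfl, .inr (by omega), rfl⟩, h0r⟩
    · refine ⟨f (i - 1), ⟨i - 1, by omega, .inl (by omega), rfl⟩, ?_⟩
      have := hf.adj (i - 1) (by omega)
      rw [Nat.sub_add_cancel (by omega)] at this
      exact this.symm
  · by_cases hj' : j = r
    · subst hj'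
      exact ⟨f 0, ⟨0, by omega, .inl (by omega), rfl⟩, h0r.symm⟩
    · exact ⟨f (j + 1), ⟨j + 1, by omega, .inr (by omega), rfl⟩, hf.adj j (by omega)⟩

/-- A connected set away from a detour attaches to it only at two consecutive vertices. -/
theorem attach_consecutive (hf : G.IsDetour D u v r f) (hθ : G.ThetaFree) (hK : G.EdgeK4Free)
    (huv : G.Adj u v) (hD : G.ConnSet D) (hu : u ∉ D) (hv : v ∉ D) {C : Set V} (hC : G.ConnSet C)
    (hCD : C ⊆ D) (hCf : Disjoint C (verts r f))
    (hCN : ∀ x ∈ C, ∀ y, G.Adj x y → y ∈ C ∨ y ∈ verts r f) {i j : ℕ} (hij : i < j)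
    (hj : j ≤ r) (hi' : ∃ x ∈ C, G.Adj (f i) x) (hj' : ∃ x ∈ C, G.Adj (f j) x) : j = i + 1 := by
  by_contra hne
  have hfC : ∀ k ≤ r, f k ∉ C := fun k hk h => Set.disjoint_left.1 hCf h ⟨k, hk, rfl⟩
  let M : Set V := {y | ∃ k, i < k ∧ k < j ∧ f k = y}
  have hM : G.ConnSet M := by
    refine ⟨⟨f (i + 1), i + 1, by omega, by omega, rfl⟩, ?_⟩
    have key : ∀ k, i < k → k < j → G.Linked M (f (i + 1)) (f k) := fun k h h' =>
      linked_segment h (fun l _ hl => hf.adj l (by omega))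
        (fun l hl hl' => ⟨l, by omega, by omega, rfl⟩)
    rintro _ ⟨k, hk, hk', rfl⟩ _ ⟨l, hl, hl', rfl⟩
    exact (key k hk hk').symm.trans (key l hl hl')
  have hMi : f i ∉ M := by
    rintro ⟨k, hk, hk', e⟩
    have := hf.inj (by omega) (by omega) e
    omega
  have hMj : f j ∉ M := by
    rintro ⟨k, hk, hk', e⟩
    have := hf.inj (by omega) (by omega) e
    omega
  have hMi' : ∃ x ∈ M, G.Adj (f i) x :=
    ⟨f (i + 1), ⟨i + 1, by omega, by omega, rfl⟩, hf.adj i (by omega)⟩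
  have hMj' : ∃ x ∈ M, G.Adj (f j) x := by
    refine ⟨f (j - 1), ⟨j - 1, by omega, by omega, rfl⟩, ?_⟩
    have := hf.adj (j - 1) (by omega)
    rw [Nat.sub_add_cancel (by omega)] at this
    exact this.symm
  have hCM : Disjoint C M := hCf.mono_right (by rintro _ ⟨k, hk, hk', rfl⟩; exact ⟨k, by omega, rfl⟩)
  -- If the segment is the whole detour, the outer arc is empty. In that case connectedness of `D`
  -- makes `C` adjacent to the interior `M`, and `C`, `M` violate `EdgeK4Free` at the edge `uv`.
  -- Otherwise `C`, `M` and the outer arc violate `ThetaFree`.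
  by_cases h0 : i = 0 ∧ j = r
  · obtain ⟨rfl, rfl⟩ := h0
    have hadj : G.Adj (f 0) (f j) := by rw [hf.start, hf.finish]; exact huv
    refine hK (f 0) (f j) C M hadj hC hM hCM (hfC _ (by omega)) (hfC _ (by omega)) hMi hMj hi' hj'
      hMi' hMj' ?_
    obtain ⟨x, hx⟩ := hC.1
    obtain ⟨a, ha, b, hb, haD, hbD, hab⟩ := (hD.2 x (hCD hx) (f 1)
      (hf.mem 1 (by omega) (by omega))).exists_adj_boundary hx (hfC 1 (by omega))
    rcases hCN a ha b hab with h | ⟨k, hk, rfl⟩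
    · exact absurd h hb
    · refine ⟨a, ha, f k, ⟨k, ?_, ?_, rfl⟩, hab⟩
      · by_contra hk0
        obtain rfl : k = 0 := by omega
        exact hu (hf.start ▸ hbD)
      · by_contra hkj
        obtain rfl : k = j := by omega
        exact hv (hf.finish ▸ hbD)
  · obtain ⟨hO, hOi, hOj, hOi', hOj'⟩ := hf.outer_spec huv hij hj h0
    have hCO : Disjoint C (outer r f i j) :=
      hCf.mono_right (by rintro _ ⟨k, hk, -, rfl⟩; exact ⟨k, hk, rfl⟩)
    have hMO : Disjoint M (outer r f i j) := by
      rw [Set.disjoint_left]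
      rintro _ ⟨k, hk, hk', rfl⟩ ⟨l, hl, hl', e⟩
      have := hf.inj hl (by omega) e
      omega
    refine hθ (f i) (f j) ![C, M, outer r f i j] (hf.ne i j hij hj) ?_ ?_ ?_ ?_ ?_ ?_
    · intro k; fin_cases k; exacts [hC, hM, hO]
    · intro k l hkl
      fin_cases k <;> fin_cases l <;> first | exact absurd rfl hkl | skip
      exacts [hCM, hCO, hCM.symm, hMO, hCO.symm, hMO.symm]
    · intro k; fin_cases k; exacts [hfC _ (by omega), hMi, hOi]
    · intro k; fin_cases k; exacts [hfC _ (by omega), hMj, hOj]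
    · intro k; fin_cases k; exacts [hi', hMi', hOi']
    · intro k; fin_cases k; exacts [hj', hMj', hOj']

end IsDetour

end SimpleGraph

/-! ### Lobes and the 2-connected case -/

namespace SimpleGraph

variable {V : Type*} {G : SimpleGraph V}

/-- `D` is empty or a component of `G - {u, v}` that attaches to both ends of the edge `uv`. -/
structure IsLobe (G : SimpleGraph V) (D : Set V) (u v : V) : Prop where
  adj : G.Adj u v
  left : u ∉ D
  right : v ∉ D
  closed : ∀ x ∈ D, ∀ y, G.Adj x y → y ∈ D ∨ y = u ∨ y = v
  attach : D = ∅ ∨ G.ConnSet D ∧ (∃ x ∈ D, G.Adj u x) ∧ ∃ x ∈ D, G.Adj v x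

/-- In a `2`-connected graph a connected set attaches to at least two vertices. -/
theorem exists_attach_ne (h2 : ∀ w, G.ConnSet {w}ᶜ) {C : Set V} {x t w : V} (hx : x ∈ C)
    (hw : w ∉ C) (ht : t ∉ C) (htw : t ≠ w) : ∃ a ∈ C, ∃ b ∉ C, b ≠ w ∧ G.Adj a b := by
  obtain ⟨a, ha, b, hb, -, hbw, hab⟩ := ((h2 w).2 x (fun e => hw (e ▸ hx)) t htw).exists_adj_boundary
    hx ht
  exact ⟨a, ha, b, hb, hbw, hab⟩

namespace IsDetour

variable {D : Set V} {u v : V} {r : ℕ} {f : ℕ → V}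

/-- By 2-connectedness the component attaches to at least two detour vertices, and any two of these
are consecutive. As `r ≥ 2`, they are exactly `f i` and `f (i + 1)`. -/
theorem exists_isLobe_compIn (hf : G.IsDetour D u v r f) (hθ : G.ThetaFree) (hK : G.EdgeK4Free)
    (h2 : ∀ w, G.ConnSet {w}ᶜ) (huv : G.Adj u v) (hD : G.ConnSet D) (hu : u ∉ D) (hv : v ∉ D)
    (hN : ∀ x ∈ D, ∀ y, G.Adj x y → y ∈ D ∨ y = u ∨ y = v) {x : V} (hx : x ∈ D \ verts r f) :
    ∃ i < r, G.IsLobe (G.compIn (D \ verts r f) x) (f i) (f (i + 1)) := by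
  set C := G.compIn (D \ verts r f) x with hCdef
  have hC : G.ConnSet C := connSet_compIn hx
  have hxC : x ∈ C := mem_compIn_self hx
  have hCD : C ⊆ D := fun y hy => (compIn_subset hy).1
  have hCf : Disjoint C (verts r f) := Set.disjoint_left.2 fun y hy => (compIn_subset hy).2
  have hCN : ∀ a ∈ C, ∀ b, G.Adj a b → b ∈ C ∨ b ∈ verts r f := by
    intro a ha b hab
    by_cases hb : b ∈ verts r f
    · exact .inr hb
    · refine .inl (mem_compIn_of_adj ha hab ⟨?_, hb⟩)
      rcases hN a (hCD ha) b hab with h | rfl | rfl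
      · exact h
      · exact absurd ⟨0, by omega, hf.start⟩ hb
      · exact absurd ⟨r, le_rfl, hf.finish⟩ hb
  have hfC : ∀ k ≤ r, f k ∉ C := fun k hk h => Set.disjoint_left.1 hCf h ⟨k, hk, rfl⟩
  have hr := hf.two_le
  have two : ∀ i ≤ r, ∃ j ≤ r, j ≠ i ∧ ∃ y ∈ C, G.Adj (f j) y := by
    intro i hi
    obtain ⟨k, hk, hki⟩ : ∃ k ≤ r, k ≠ i := by
      by_cases h : i = 0
      · exact ⟨1, by omega, by omega⟩
      · exact ⟨0, by omega, by omega⟩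
    obtain ⟨a, ha, b, hb, hbi, hab⟩ := exists_attach_ne h2 hxC (hfC i hi) (hfC k hk)
      (fun e => hki (hf.inj hk hi e))
    rcases hCN a ha b hab with h | ⟨j, hj, rfl⟩
    · exact absurd h hb
    · exact ⟨j, hj, fun e => hbi (by rw [e]), a, ha, hab.symm⟩
  have cons : ∀ i j, i < j → j ≤ r → (∃ y ∈ C, G.Adj (f i) y) → (∃ y ∈ C, G.Adj (f j) y) →
      j = i + 1 := fun i j hij hj hi' hj' =>
    hf.attach_consecutive hθ hK huv hD hu hv hC hCD hCf hCN hij hj hi' hj'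
  obtain ⟨i, hir, hi, hi1⟩ : ∃ i < r, (∃ y ∈ C, G.Adj (f i) y) ∧ ∃ y ∈ C, G.Adj (f (i + 1)) y := by
    obtain ⟨i, hi, -, hi'⟩ := two 0 (by omega)
    obtain ⟨j, hj, hij, hj'⟩ := two i hi
    rcases lt_or_gt_of_ne hij with h | h
    · obtain rfl := cons j i h hi hj' hi'
      exact ⟨j, by omega, hj', hi'⟩
    · obtain rfl := cons i j h hj hi' hj'
      exact ⟨i, by omega, hi', hj'⟩
  refine ⟨i, hir, hf.adj i hir, hfC i hir.le, hfC _ hir, fun a ha b hab => ?_, .inr ⟨hC, hi, hi1⟩⟩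
  rcases hCN a ha b hab with h | ⟨k, hk, rfl⟩
  · exact .inl h
  · refine .inr ?_
    have hk' : ∃ y ∈ C, G.Adj (f k) y := ⟨a, ha, hab.symm⟩
    by_cases h1 : k = i
    · exact .inl (by rw [h1])
    · by_cases h2 : k = i + 1
      · exact .inr (by rw [h2])
      · exfalso
        rcases lt_or_gt_of_ne h1 with h | h
        · have := cons k (i + 1) (by omega) (by omega) hk' hi1
          omega
        · have := cons i k h hk hi hk'
          omega

/-- Two components on one detour edge, together with the rest of the cycle, would form a forbidden
theta. -/
theorem compIn_unique (hf : G.IsDetour D u v r f) (hθ : G.ThetaFree) (huv : G.Adj u v)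
    {x y : V} (hx : x ∈ D \ verts r f) (hy : y ∈ D \ verts r f) {i : ℕ} (hi : i < r)
    (hxi : G.IsLobe (G.compIn (D \ verts r f) x) (f i) (f (i + 1)))
    (hyi : G.IsLobe (G.compIn (D \ verts r f) y) (f i) (f (i + 1))) :
    y ∈ G.compIn (D \ verts r f) x := by
  by_contra hne
  have hr := hf.two_le
  obtain ⟨hO, hOi, hOj, hOi', hOj'⟩ := hf.outer_spec huv (Nat.lt_succ_self i) hi (by omega)
  have hout : ∀ z, Disjoint (G.compIn (D \ verts r f) z) (outer r f i (i + 1)) := fun z => by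
    rw [Set.disjoint_left]
    rintro w hw ⟨k, hk, -, rfl⟩
    exact (compIn_subset hw).2 ⟨k, hk, rfl⟩
  have hxi' := hxi.attach.resolve_left (Set.nonempty_iff_ne_empty.1 ⟨x, mem_compIn_self hx⟩)
  have hyi' := hyi.attach.resolve_left (Set.nonempty_iff_ne_empty.1 ⟨y, mem_compIn_self hy⟩)
  refine hθ (f i) (f (i + 1)) ![G.compIn (D \ verts r f) x,
    G.compIn (D \ verts r f) y, outer r f i (i + 1)] (hf.ne _ _ (Nat.lt_succ_self i) hi)
    ?_ ?_ ?_ ?_ ?_ ?_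
  · intro k; fin_cases k; exacts [hxi'.1, hyi'.1, hO]
  · intro k l hkl
    have hxy := disjoint_compIn hne
    fin_cases k <;> fin_cases l <;> first | exact absurd rfl hkl | skip
    exacts [hxy, hout x, hxy.symm, hout y, (hout x).symm, (hout y).symm]
  · intro k; fin_cases k; exacts [hxi.left, hyi.left, hOi]
  · intro k; fin_cases k; exacts [hxi.right, hyi.right, hOj]
  · intro k; fin_cases k; exacts [hxi'.2.1, hyi'.2.1, hOi']
  · intro k; fin_cases k; exacts [hxi'.2.2, hyi'.2.2, hOj']

/-- `D` consists of the `r - 1` interior vertices of the detour and at most one component per detour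
edge, so `|D| ≤ (r - 1) + r * |C|` for a largest component `C`, taken empty if there is none. -/
theorem exists_large_lobe [Finite V] (hf : G.IsDetour D u v r f) (hθ : G.ThetaFree)
    (hK : G.EdgeK4Free) (h2 : ∀ w, G.ConnSet {w}ᶜ) (huv : G.Adj u v) (hD : G.ConnSet D)
    (hu : u ∉ D) (hv : v ∉ D) (hN : ∀ x ∈ D, ∀ y, G.Adj x y → y ∈ D ∨ y = u ∨ y = v) :
    ∃ i < r, ∃ C ⊆ D, C.ncard < D.ncard ∧ D.ncard + 1 ≤ r * (C.ncard + 1) ∧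
      Disjoint C (verts r f) ∧ G.IsLobe C (f i) (f (i + 1)) := by
  classical
  have hr := hf.two_le
  have hf1 : f 1 ∈ D := hf.mem 1 (by omega) (by omega)
  obtain ⟨i, hir, C, hCs, hCl, hCmax⟩ : ∃ i < r, ∃ C ⊆ D \ verts r f,
      G.IsLobe C (f i) (f (i + 1)) ∧
      ∀ x ∈ D \ verts r f, (G.compIn (D \ verts r f) x).ncard ≤ C.ncard := by
    by_cases hne : (D \ verts r f).Nonempty
    · obtain ⟨x, hx, hmax⟩ := (Set.toFinite (D \ verts r f)).exists_maximalFor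
        (fun x => (G.compIn (D \ verts r f) x).ncard) _ hne
      obtain ⟨i, hi, hl⟩ := hf.exists_isLobe_compIn hθ hK h2 huv hD hu hv hN hx
      exact ⟨i, hi, _, compIn_subset, hl, fun y hy => (le_total _ _).elim id (hmax hy)⟩
    · refine ⟨0, by omega, ∅, Set.empty_subset _, ⟨hf.adj 0 (by omega), by simp, by simp, by simp,
        .inl rfl⟩, fun x hx => absurd ⟨x, hx⟩ hne⟩
  refine ⟨i, hir, C, fun y hy => (hCs hy).1, ?_, ?_, Set.disjoint_left.2 fun y hy => (hCs hy).2, hCl⟩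
  · exact Set.ncard_lt_ncard ⟨fun y hy => (hCs hy).1, fun h => (hCs (h hf1)).2 ⟨1, by omega, rfl⟩⟩
  · have h1 : (D ∩ verts r f).ncard ≤ r - 1 := by
      have : D ∩ verts r f ⊆ f '' (Finset.Ioo 0 r : Finset ℕ) := by
        rintro _ ⟨hy, k, hk, rfl⟩
        refine ⟨k, ?_, rfl⟩
        have h0 : k ≠ 0 := by rintro rfl; exact hu (hf.start ▸ hy)
        have h0' : k ≠ r := by rintro rfl; exact hv (hf.finish ▸ hy)
        simp; omega
      refine (Set.ncard_le_ncard this).trans ((Set.ncard_image_le (Finset.finite_toSet _)).trans ?_)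
      rw [Set.ncard_coe_finset]; simp
    have h3 : (D \ verts r f).ncard ≤ C.ncard * r := by
      choose! g hg hgl using fun x (hx : x ∈ D \ verts r f) =>
        hf.exists_isLobe_compIn hθ hK h2 huv hD hu hv hN hx
      have hfin := Set.toFinite (D \ verts r f)
      rw [Set.ncard_eq_toFinset_card _ hfin]
      have := Finset.card_le_mul_card_image_of_maps_to (s := hfin.toFinset) (t := Finset.range r)
        (f := g) (fun x hx => Finset.mem_range.2 (hg x (by simpa using hx))) C.ncard (by
          intro k hk
          by_cases hne : ∃ x ∈ D \ verts r f, g x = k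
          · obtain ⟨x, hx, rfl⟩ := hne
            refine le_trans ?_ (hCmax x hx)
            rw [← Set.ncard_coe_finset]
            refine Set.ncard_le_ncard fun y hy => ?_
            simp only [Finset.coe_filter, Set.Finite.mem_toFinset, Set.mem_ofPred_eq] at hy
            exact hf.compIn_unique hθ huv hx hy.1 (hg x hx) (hgl x hx) (hy.2 ▸ hgl y hy.1)
          · have : (hfin.toFinset.filter fun x => g x = k) = ∅ := by
              refine Finset.filter_eq_empty_iff.2 fun x hx e => hne ⟨x, by simpa using hx, e⟩
            simp [this])
      simpa using this
    have h4 := Set.ncard_inter_add_ncard_sdiff_eq_ncard D (verts r f)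
    rw [mul_add, mul_one, mul_comm r]
    omega

end IsDetour

/-- The main recursion: a lobe contains two long induced paths starting at its two ends. -/
theorem IsLobe.exists_induced_paths [Finite V] (hθ : G.ThetaFree)
    (hK : G.EdgeK4Free) (h2 : ∀ w, G.ConnSet {w}ᶜ) (n : ℕ) : ∀ (D : Set V) (u v : V),
    D.ncard = n → G.IsLobe D u v → ∃ P Q : List V, G.IsIndList (u :: P) ∧ G.IsIndList (v :: Q) ∧
      (∀ x ∈ P, x ∈ D) ∧ (∀ x ∈ Q, x ∈ D) ∧ D.ncard + 1 ≤ 2 ^ (P.length + Q.length) := by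
  induction n using Nat.strong_induction_on with
  | _ n ih =>
  intro D u v hn hl
  rcases hl.attach with rfl | ⟨hD, hDu, hDv⟩
  · exact ⟨[], [], trivial, trivial, by simp, by simp, by simp⟩
  obtain ⟨r, f, hf⟩ := exists_isDetour hl.adj.ne hl.left hl.right hD hDu hDv
  have hr := hf.two_le
  obtain ⟨i, hir, C, hCD, hlt, hcard, hdis, hCl⟩ := hf.exists_large_lobe hθ hK h2 hl.adj hD
    hl.left hl.right hl.closed
  obtain ⟨P, Q, hP, hQ, hPC, hQC, hPQ⟩ := ih _ (hn ▸ hlt) C _ _ rfl hCl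
  have hfC : ∀ k ≤ r, f k ∉ C := fun k hk h => Set.disjoint_left.1 hdis h ⟨k, hk, rfl⟩
  have hfadj : ∀ k ≤ r, k ≠ i → k ≠ i + 1 → ∀ y ∈ C, ¬ G.Adj (f k) y := by
    intro k hk h1 h2 y hy hadj
    rcases hCl.closed y hy _ hadj.symm with h | h | h
    · exact hfC k hk h
    · exact h1 (hf.inj hk hir.le h)
    · exact h2 (hf.inj hk hir h)
  have hadj_iff : ∀ a b, a < b → b ≤ r → ¬ (a = 0 ∧ b = r) → (G.Adj (f a) (f b) ↔ b = a + 1) := by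
    intro a b hab hb h
    refine ⟨fun h' => (hf.eq_succ a b hab hb h').resolve_right h, ?_⟩
    rintro rfl
    exact hf.adj a (by omega)
  obtain ⟨P', hP'l, hP', hP'm⟩ := hP.prepend_path i f
    -- As `i < r`, this initial segment does not contain both ends of the possible chord `uv`, so it
    -- is induced.
    (fun a b hab hb => ⟨hf.ne a b hab (by omega), hadj_iff a b hab (by omega) (by omega)⟩)
    (fun a ha y hy => ⟨hfadj a (by omega) (by omega) (by omega) y (hPC y hy),
      fun e => hfC a (by omega) (e ▸ hPC y hy)⟩)
  have hri : r - (r - 1 - i) = i + 1 := by omega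
  rw [← hri] at hQ
  obtain ⟨Q', hQ'l, hQ', hQ'm⟩ := hQ.prepend_path (r - 1 - i) (fun a => f (r - a))
    (fun a b hab hb => ⟨(hf.ne _ _ (by omega) (by omega)).symm, by
      rw [G.adj_comm, hadj_iff _ _ (by omega) (by omega) (by omega)]; omega⟩)
    (fun a ha y hy => ⟨hfadj _ (by omega) (by omega) (by omega) y (hQC y hy),
      fun e => hfC (r - a) (by omega) (e ▸ hQC y hy)⟩)
  refine ⟨P', Q', hf.start ▸ hP', by simpa [hf.finish] using hQ', fun x hx => ?_, fun x hx => ?_, ?_⟩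
  · rcases hP'm x hx with h | ⟨a, ha, hai, rfl⟩
    · exact hCD (hPC x h)
    · exact hf.mem a ha (by omega)
  · rcases hQ'm x hx with h | ⟨a, ha, hai, rfl⟩
    · exact hCD (hQC x h)
    · exact hf.mem _ (by omega) (by omega)
  -- The two segments add `i` and `r - 1 - i` vertices.
  · have e : P'.length + Q'.length = (r - 1) + (P.length + Q.length) := by omega
    have h3 : r ≤ 2 ^ (r - 1) := by
      have := (r - 1).lt_two_pow_self
      omega
    rw [e, pow_add]
    exact hcard.trans (Nat.mul_le_mul h3 hPQ)

/-- A `2`-connected graph on `m` vertices has an induced path of size at least `(log m) / 2`. -/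
theorem exists_induced_path_of_twoConnected [Finite V] (hθ : G.ThetaFree) (hK : G.EdgeK4Free)
    (h1 : G.ConnSet Set.univ) (h2 : ∀ w, G.ConnSet {w}ᶜ) :
    ∃ l : List V, G.IsIndList l ∧ Nat.card V ≤ 4 ^ l.length := by
  classical
  obtain ⟨u, -⟩ := h1.1
  obtain ⟨v', hv'⟩ := (h2 u).1
  obtain ⟨v, huv⟩ : ∃ v, G.Adj u v := by
    obtain ⟨_, rfl, v, -, -, -, huv⟩ := (h1.2 u trivial v' trivial).exists_adj_boundary
      (C := {u}) rfl hv'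
    exact ⟨v, huv⟩
  let S : Set V := {u, v}ᶜ
  have hclosed : ∀ x, ∀ a ∈ G.compIn S x, ∀ b, G.Adj a b → b ∈ G.compIn S x ∨ b = u ∨ b = v := by
    intro x a ha b hab
    by_cases hb : b ∈ S
    · exact .inl (mem_compIn_of_adj ha hab hb)
    · exact .inr (by simpa [S] using Set.notMem_compl_iff.1 hb)
  have hl : ∀ x ∈ S, G.IsLobe (G.compIn S x) u v := by
    intro x hx
    have hu : u ∉ G.compIn S x := fun h => compIn_subset h (by simp)
    have hv : v ∉ G.compIn S x := fun h => compIn_subset h (by simp)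
    refine ⟨huv, hu, hv, hclosed x, .inr ⟨connSet_compIn hx, ?_, ?_⟩⟩
    · obtain ⟨a, ha, b, hb, hbw, hab⟩ := exists_attach_ne h2 (mem_compIn_self hx) hv hu huv.ne
      rcases hclosed x a ha b hab with h | rfl | rfl
      exacts [absurd h hb, ⟨a, ha, hab.symm⟩, absurd rfl hbw]
    · obtain ⟨a, ha, b, hb, hbw, hab⟩ := exists_attach_ne h2 (mem_compIn_self hx) hu hv huv.ne'
      rcases hclosed x a ha b hab with h | rfl | rfl
      exacts [absurd h hb, absurd rfl hbw, ⟨a, ha, hab.symm⟩]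
  -- Three components of `G - {u, v}` would form a theta with ends `u`, `v`, so the larger of at
  -- most two has half the vertices.
  obtain ⟨C, hC, hcard⟩ : ∃ C, G.IsLobe C u v ∧ S.ncard ≤ 2 * C.ncard := by
    rcases S.eq_empty_or_nonempty with hS | ⟨x, hx⟩
    · exact ⟨∅, ⟨huv, by simp, by simp, by simp, .inl rfl⟩, by simp [hS]⟩
    by_cases hall : S ⊆ G.compIn S x
    · exact ⟨_, hl x hx, (Set.ncard_le_ncard hall).trans (by omega)⟩
    obtain ⟨y, hy, hyx⟩ := Set.not_subset.1 hall
    have hall' : S ⊆ G.compIn S x ∪ G.compIn S y := by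
      intro z hz
      by_contra hzn
      simp only [Set.mem_union, not_or] at hzn
      have att : ∀ w ∈ S, G.ConnSet (G.compIn S w) ∧ (∃ a ∈ G.compIn S w, G.Adj u a) ∧
          ∃ a ∈ G.compIn S w, G.Adj v a := fun w hw => (hl w hw).attach.resolve_left
        (Set.nonempty_iff_ne_empty.1 ⟨w, mem_compIn_self hw⟩)
      let w : Fin 3 → V := ![x, y, z]
      have hw : ∀ k, w k ∈ S := by
        intro k; fin_cases k; exacts [hx, hy, hz]
      refine hθ u v (fun k => G.compIn S (w k)) huv.ne (fun k => (att _ (hw k)).1) ?_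
        (fun k => (hl _ (hw k)).left) (fun k => (hl _ (hw k)).right)
        (fun k => (att _ (hw k)).2.1) (fun k => (att _ (hw k)).2.2)
      intro k l hkl
      fin_cases k <;> fin_cases l <;> first | exact absurd rfl hkl | skip
      exacts [disjoint_compIn hyx, disjoint_compIn hzn.1, (disjoint_compIn hyx).symm,
        disjoint_compIn hzn.2, (disjoint_compIn hzn.1).symm, (disjoint_compIn hzn.2).symm]
    have h3 := (Set.ncard_le_ncard hall').trans (Set.ncard_union_le _ _)
    rcases le_total (G.compIn S x).ncard (G.compIn S y).ncard with h | h
    · exact ⟨_, hl y hy, by omega⟩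
    · exact ⟨_, hl x hx, by omega⟩
  obtain ⟨P, Q, hP, hQ, -, -, hPQ⟩ := IsLobe.exists_induced_paths hθ hK h2 _ C u v rfl hC
  have hV : Nat.card V = S.ncard + 2 := by
    rw [← Set.ncard_pair huv.ne, add_comm, Set.ncard_add_ncard_compl]
  have key : ∀ L : List V, P.length + Q.length ≤ 2 * L.length → ∀ w,
      Nat.card V ≤ 4 ^ (w :: L).length := by
    intro L hL w
    have h3 : 2 ^ (P.length + Q.length) ≤ 4 ^ L.length := by
      rw [show (4 : ℕ) = 2 ^ 2 by norm_num, ← pow_mul]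
      exact Nat.pow_le_pow_right (by norm_num) hL
    rw [List.length_cons, pow_succ]
    omega
  rcases le_total P.length Q.length with h | h
  · exact ⟨v :: Q, hQ, key Q (by omega) v⟩
  · exact ⟨u :: P, hP, key P (by omega) u⟩

end SimpleGraph

namespace SimpleGraph

variable {V : Type*} {G : SimpleGraph V}

/-! ### Passing to induced subgraphs -/

theorem linked_induce_iff {S : Set V} {T : Set S} {x y : S} :
    (G.induce S).Linked T x y ↔ G.Linked (Subtype.val '' T) x y := by
  constructor
  · rintro ⟨p, hp⟩
    let φ : G.induce S →g G := ⟨Subtype.val, fun h => h⟩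
    refine ⟨p.map φ, fun z hz => ?_⟩
    rw [Walk.support_map, List.mem_map] at hz
    obtain ⟨w, hw, rfl⟩ := hz
    exact ⟨w, hp w hw, rfl⟩
  · rintro ⟨p, hp⟩
    have hS : ∀ z ∈ p.support, z ∈ S := fun z hz => by
      obtain ⟨w, -, rfl⟩ := hp z hz
      exact w.2
    refine ⟨p.induce S hS, fun z hz => ?_⟩
    have : (z : V) ∈ p.support := by
      have h := List.mem_map_of_mem (f := Subtype.val) hz
      simpa using h
    obtain ⟨w, hw, e⟩ := hp _ this
    exact Subtype.ext e ▸ hw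

theorem connSet_induce_iff {S : Set V} {T : Set S} :
    (G.induce S).ConnSet T ↔ G.ConnSet (Subtype.val '' T) := by
  simp only [ConnSet, Set.image_nonempty, Set.forall_mem_image, linked_induce_iff]

theorem linked_univ_iff {x y : V} : G.Linked Set.univ x y ↔ G.Reachable x y :=
  ⟨fun ⟨p, _⟩ => ⟨p⟩, fun ⟨p⟩ => ⟨p, fun _ _ => trivial⟩⟩

theorem connSet_univ_iff : G.ConnSet Set.univ ↔ G.Connected := by
  simp only [ConnSet, linked_univ_iff, connected_iff, ← Set.nonempty_iff_univ_nonempty, Preconnected,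
    Set.mem_univ, true_implies, and_comm]

theorem connected_induce_iff_connSet {S : Set V} : (G.induce S).Connected ↔ G.ConnSet S := by
  rw [← connSet_univ_iff, connSet_induce_iff, Set.image_univ, Subtype.range_coe]

theorem reachable_induce_iff {S : Set V} {x y : S} :
    (G.induce S).Reachable x y ↔ G.Linked S x y := by
  rw [← linked_univ_iff, linked_induce_iff, Set.image_univ, Subtype.range_coe]

theorem ThetaFree.induce (h : G.ThetaFree) (S : Set V) : (G.induce S).ThetaFree := by
  intro p q A hpq hA hdis hp hq hpA hqA
  refine h p q (fun i => Subtype.val '' A i) (by simpa [Subtype.ext_iff] using hpq)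
    (fun i => connSet_induce_iff.1 (hA i))
    (fun i j hij => (Set.disjoint_image_iff Subtype.val_injective).2 (hdis i j hij))
    (fun i => by simpa using hp i) (fun i => by simpa using hq i) (fun i => ?_) (fun i => ?_)
  · obtain ⟨x, hx, hpx⟩ := hpA i
    exact ⟨x, ⟨x, hx, rfl⟩, hpx⟩
  · obtain ⟨x, hx, hpx⟩ := hqA i
    exact ⟨x, ⟨x, hx, rfl⟩, hpx⟩

theorem EdgeK4Free.induce (h : G.EdgeK4Free) (S : Set V) : (G.induce S).EdgeK4Free := by
  rintro u v A B huv hA hB hAB h1 h2 h3 h4 ⟨a, ha, hua⟩ ⟨a', ha', hva⟩ ⟨b, hb, hub⟩ ⟨b', hb', hvb⟩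
    ⟨x, hx, y, hy, hxy⟩
  exact h u v (Subtype.val '' A) (Subtype.val '' B) huv (connSet_induce_iff.1 hA)
    (connSet_induce_iff.1 hB) ((Set.disjoint_image_iff Subtype.val_injective).2 hAB)
    (by simpa using h1) (by simpa using h2) (by simpa using h3) (by simpa using h4)
    ⟨a, ⟨a, ha, rfl⟩, hua⟩ ⟨a', ⟨a', ha', rfl⟩, hva⟩ ⟨b, ⟨b, hb, rfl⟩, hub⟩
    ⟨b', ⟨b', hb', rfl⟩, hvb⟩ ⟨x, ⟨x, hx, rfl⟩, y, ⟨y, hy, rfl⟩, hxy⟩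

/-! ### Blocks -/

/-- `S` induces a connected subgraph on at least two vertices without cut-vertices. -/
structure Biconn (G : SimpleGraph V) (S : Set V) : Prop where
  nontrivial : S.Nontrivial
  conn : G.ConnSet S
  conn_diff : ∀ w, G.ConnSet (S \ {w})

theorem Adj.biconn {u v : V} (h : G.Adj u v) : G.Biconn {u, v} := by
  have huv : G.ConnSet {u, v} := (connSet_singleton u).union (connSet_singleton v) rfl rfl (.inl h)
  refine ⟨⟨u, by simp, v, by simp, h.ne⟩, huv, fun w => ?_⟩
  by_cases hu : w = u
  · subst hu
    have : ({w, v} : Set V) \ {w} = {v} := by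
      ext x; simp only [Set.mem_sdiff, Set.mem_insert_iff, Set.mem_singleton_iff]
      constructor
      · tauto
      · rintro rfl; exact ⟨.inr rfl, h.ne'⟩
    rw [this]
    exact connSet_singleton v
  · by_cases hv : w = v
    · subst hv
      have : ({u, w} : Set V) \ {w} = {u} := by
        ext x; simp only [Set.mem_sdiff, Set.mem_insert_iff, Set.mem_singleton_iff]
        constructor
        · tauto
        · rintro rfl; exact ⟨.inl rfl, h.ne⟩
      rw [this]
      exact connSet_singleton u
    · rwa [Set.sdiff_singleton_eq_self (by simp [hu, hv])]

/-- Adding an ear to a biconnected set. -/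
theorem Biconn.union_path {S : Set V} (hS : G.Biconn S) {a b : V} (ha : a ∈ S) (hb : b ∈ S)
    (p : G.Walk a b) (hp : p.IsPath) : G.Biconn (S ∪ {z | z ∈ p.support}) := by
  classical
  have hsub : ∀ w, S \ {w} ⊆ (S ∪ {z | z ∈ p.support}) \ {w} := fun w x hx => ⟨.inl hx.1, hx.2⟩
  refine ⟨hS.nontrivial.mono Set.subset_union_left, ?_, fun w => ?_⟩
  · have key : ∀ z ∈ S ∪ {z | z ∈ p.support}, G.Linked (S ∪ {z | z ∈ p.support}) z a := by
      rintro z (hz | hz)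
      · exact (hS.conn.2 z hz a ha).mono Set.subset_union_left
      · exact Linked.symm ⟨p.takeUntil z hz, fun x hx =>
          .inr (p.support_takeUntil_subset_support hz hx)⟩
    exact ⟨⟨a, .inl ha⟩, fun x hx y hy => (key x hx).trans (key y hy).symm⟩
  · have key : ∀ z ∈ (S ∪ {z | z ∈ p.support}) \ {w}, ∃ s ∈ S \ {w},
        G.Linked ((S ∪ {z | z ∈ p.support}) \ {w}) z s := by
      rintro z ⟨hz | hz, hzw⟩
      · exact ⟨z, ⟨hz, hzw⟩, .refl ⟨.inl hz, hzw⟩⟩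
      -- The vertex `w` lies on at most one side of `z` on the path; the other side leads from `z`
      -- to an end in `S`.
      · by_cases hw : w ∈ (p.takeUntil z hz).support
        · have hw' : w ∉ (p.dropUntil z hz).support := by
            intro hw'
            have hnd := hp.support_nodup
            rw [← p.take_spec hz, Walk.support_append] at hnd
            rw [← Walk.cons_tail_support, List.mem_cons] at hw'
            rcases hw' with h | h
            · exact hzw h.symm
            · exact (List.nodup_append.1 hnd).2.2 w hw w h rfl
          refine ⟨b, ⟨hb, fun e => hw' ?_⟩, p.dropUntil z hz, fun x hx =>
            ⟨.inr (p.support_dropUntil_subset_support hz hx), fun e => hw' ?_⟩⟩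
          · rw [← Set.mem_singleton_iff.1 e]; exact Walk.end_mem_support _
          · rw [← Set.mem_singleton_iff.1 e]; exact hx
        · refine ⟨a, ⟨ha, fun e => hw ?_⟩, Linked.symm ⟨p.takeUntil z hz, fun x hx =>
            ⟨.inr (p.support_takeUntil_subset_support hz hx), fun e => hw ?_⟩⟩⟩
          · rw [← Set.mem_singleton_iff.1 e]; exact Walk.start_mem_support _
          · rw [← Set.mem_singleton_iff.1 e]; exact hx
    refine ⟨(hS.conn_diff w).1.mono (hsub w), fun x hx y hy => ?_⟩
    obtain ⟨s, hs, hxs⟩ := key x hx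
    obtain ⟨t, ht, hyt⟩ := key y hy
    exact hxs.trans ((((hS.conn_diff w).2 s hs t ht).mono (hsub w)).trans hyt.symm)

theorem Biconn.exists_maximal [Finite V] {S : Set V} (hS : G.Biconn S) :
    ∃ B, S ⊆ B ∧ Maximal G.Biconn B :=
  (Set.toFinite {T | G.Biconn T}).exists_le_maximal hS

theorem isTwoConnected_induce_iff {S : Set V} :
    (G.induce S).IsTwoConnected ↔ 3 ≤ S.encard ∧ G.Biconn S := by
  have hdiff : ∀ v : S, (Subtype.val '' ({v}ᶜ : Set S)) = S \ {v.1} := fun v => by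
    ext x
    constructor
    · rintro ⟨y, hy, rfl⟩
      exact ⟨y.2, fun e => hy (Subtype.ext e)⟩
    · rintro ⟨hx, hxv⟩
      exact ⟨⟨x, hx⟩, fun e => hxv (congrArg Subtype.val e), rfl⟩
  unfold IsTwoConnected
  simp only [connected_induce_iff_connSet, connSet_induce_iff, hdiff]
  constructor
  · rintro ⟨h3, h1, h2⟩
    refine ⟨h3, ⟨?_, h1, fun w => ?_⟩⟩
    · exact Set.one_lt_encard_iff_nontrivial.1 (lt_of_lt_of_le (by norm_num) h3)
    · by_cases hw : w ∈ S
      · exact h2 ⟨w, hw⟩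
      · rwa [Set.sdiff_singleton_eq_self hw]
  · rintro ⟨h3, h⟩
    exact ⟨h3, h.conn, fun v => h.conn_diff v⟩

/-- `Biconn` treats 2-connected sets and single edges uniformly. A maximal one with two vertices is
a bridge, since a second path between its ends would be an ear enlarging it. -/
theorem isBlock_of_maximal_biconn {B : Set V} (hB : Maximal G.Biconn B) : G.IsBlock B := by
  classical
  by_cases h3 : 3 ≤ B.encard
  · refine .inl ⟨isTwoConnected_induce_iff.2 ⟨h3, hB.1⟩, fun T hT hBT => hB.2 ?_ hBT⟩
    exact (isTwoConnected_induce_iff.1 hT).2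
  · have h2 : B.encard = 2 := by
      have h1 := Set.one_lt_encard_iff_nontrivial.2 hB.1.nontrivial
      push Not at h3
      refine le_antisymm (Order.le_of_lt_add_one h3) ?_
      have := Order.add_one_le_of_lt h1
      simpa [one_add_one_eq_two] using this
    obtain ⟨u, v, huv, rfl⟩ := Set.encard_eq_two.1 h2
    have hadj : G.Adj u v := by
      obtain ⟨a, ha, b, hb, -, hbS, hab⟩ := (hB.1.conn.2 u (by simp) v (by simp)).exists_adj_boundary
        (C := {u}) rfl (by simpa using huv.symm)
      rcases hbS with rfl | hbv
      · exact absurd rfl hb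
      · rw [Set.mem_singleton_iff] at ha hbv
        rwa [ha, hbv] at hab
    refine .inr ⟨u, v, hadj, ?_, rfl⟩
    rw [isBridge_iff]
    intro hreach
    obtain ⟨p, hp⟩ := hreach.exists_isPath
    cases p with
    | nil => exact huv rfl
    | @cons _ x _ hux q =>
      have hle := G.deleteEdges_le {s(u, v)}
      have := hB.2 (hB.1.union_path (by simp) (by simp) _ (hp.mapLe hle)) Set.subset_union_left
      have hx : x ∈ ({u, v} : Set V) := this (.inr (by simp))
      rcases hx with rfl | rfl
      · exact hux.ne rfl
      · simp at hux

theorem Adj.exists_maximal_biconn [Finite V] {u v : V} (h : G.Adj u v) :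
    ∃ B, Maximal G.Biconn B ∧ u ∈ B ∧ v ∈ B := by
  obtain ⟨B, hs, hB⟩ := h.biconn.exists_maximal
  exact ⟨B, hB, hs (by simp), hs (by simp)⟩

/-- Such a link, preceded by the edge `ab`, would contain an ear of `B` through `b`, against
maximality. -/
theorem not_linked_of_maximal_biconn {B : Set V} (hB : Maximal G.Biconn B) {a b y : V}
    (ha : a ∈ B) (hb : b ∉ B) (hab : G.Adj a b) (hy : y ∈ B) : ¬ G.Linked {a}ᶜ b y := by
  classical
  rintro ⟨p, hp⟩
  have hq : (Walk.cons hab p.bypass).IsPath := by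
    rw [Walk.cons_isPath_iff]
    exact ⟨p.bypass_isPath, fun h => hp a (p.support_bypass_subset_support h) rfl⟩
  have := hB.2 (hB.1.union_path ha hy _ hq) Set.subset_union_left
  exact hb (this (.inr (by simp)))

/-- A biconnected set cannot reach across a vertex that separates `D` from the rest. -/
theorem Biconn.subset_insert {B D : Set V} (hB : G.Biconn B) {c d : V} (hd : d ∈ B)
    (hdD : d ∈ D) (hcD : c ∉ D) (hN : ∀ x ∈ D, ∀ y, G.Adj x y → y ∈ D ∨ y = c) :
    B ⊆ insert c D := by
  intro y hy
  by_contra hn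
  simp only [Set.mem_insert_iff, not_or] at hn
  have hdc : d ≠ c := fun e => hcD (e ▸ hdD)
  obtain ⟨a, ha, b, hb, -, hbB, hab⟩ := ((hB.conn_diff c).2 d ⟨hd, hdc⟩ y
    ⟨hy, hn.1⟩).exists_adj_boundary hdD hn.2
  rcases hN a ha b hab with h | h
  exacts [hb h, hbB.2 h]

theorem isCutVertex_of_not_linked (hG : G.Connected) {c x y : V} (hx : x ≠ c) (hy : y ≠ c)
    (h : ¬ G.Linked {c}ᶜ x y) : G.IsCutVertex c :=
  ⟨⟨x, hx⟩, ⟨y, hy⟩, hG.preconnected _ _, fun hr => h (reachable_induce_iff.1 hr)⟩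

theorem compIn_compl_closed {c x : V} : ∀ a ∈ G.compIn {c}ᶜ x, ∀ b, G.Adj a b →
    b ∈ G.compIn {c}ᶜ x ∨ b = c := by
  intro a ha b hab
  by_cases hb : b = c
  · exact .inr hb
  · exact .inl (mem_compIn_of_adj ha hab hb)

theorem exists_adj_compIn (hG : G.Connected) {c x : V} (hx : x ≠ c) :
    ∃ y ∈ G.compIn {c}ᶜ x, G.Adj c y := by
  obtain ⟨a, ha, b, hb, -, -, hab⟩ := (linked_univ_iff.2 (hG.preconnected x c)).exists_adj_boundary
    (mem_compIn_self (S := {c}ᶜ) hx) (fun h => compIn_subset h rfl)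
  rcases compIn_compl_closed a ha b hab with h | rfl
  exacts [absurd h hb, ⟨a, ha, hab.symm⟩]

/-! ### Chains of blocks in a bracelet -/

/-- If a vertex is in at most two blocks, its removal leaves at most two components. -/
theorem not_three_branches [Finite V] (hG : G.Connected) {c : V}
    (hc : {B : Set V | G.IsBlock B ∧ c ∈ B}.encard ≤ 2) (x : Fin 3 → V) (hx : ∀ i, x i ≠ c)
    (hl : ∀ i j, i ≠ j → ¬ G.Linked {c}ᶜ (x i) (x j)) : False := by
  -- Each component of `G - c` contains a neighbour of `c`, and the block of that edge stays within
  -- the component and `c`; three components would give three blocks at `c`.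
  choose y hy hcy using fun i => exists_adj_compIn hG (hx i)
  choose B hB hcB hyB using fun i => (hcy i).exists_maximal_biconn
  have hsub : ∀ i, B i ⊆ insert c (G.compIn {c}ᶜ (x i)) := fun i =>
    (hB i).1.subset_insert (hyB i) (hy i) (fun h => compIn_subset h rfl) compIn_compl_closed
  have hinj : Function.Injective B := by
    intro i j hij
    by_contra hne
    rcases hsub j (hij ▸ hyB i) with h | h
    · exact (hcy i).ne h.symm
    · exact hl i j hne (Linked.trans (hy i) (Linked.symm h))
  have : (3 : ℕ∞) ≤ 2 := calc
    (3 : ℕ∞) = (Set.range B).encard := by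
      rw [← Set.image_univ, hinj.encard_image, Set.encard_univ]; simp
    _ ≤ _ := Set.encard_le_encard (by
      rintro _ ⟨i, rfl⟩
      exact ⟨isBlock_of_maximal_biconn (hB i), hcB i⟩)
    _ ≤ 2 := hc
  exact absurd this (by decide)

/-- A shortest path inside a connected set. -/
theorem ConnSet.exists_shortest {B : Set V} (hB : G.ConnSet B) {c a : V} (hc : c ∈ B) (ha : a ∈ B)
    (hca : c ≠ a) : ∃ (r : ℕ) (f : ℕ → V), 0 < r ∧ f 0 = c ∧ f r = a ∧ (∀ i ≤ r, f i ∈ B) ∧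
      ∀ i j, i < j → j ≤ r → f i ≠ f j ∧ (G.Adj (f i) (f j) ↔ j = i + 1) := by
  let K : SimpleGraph V :=
    { Adj := fun a b => G.Adj a b ∧ a ∈ B ∧ b ∈ B
      symm := ⟨fun a b h => ⟨h.1.symm, h.2.2, h.2.1⟩⟩
      loopless := ⟨fun a h => h.1.ne rfl⟩ }
  have hK : K.Reachable c a := (hB.2 c hc a ha).reachable fun x hx y hy h => ⟨h, hx, hy⟩
  obtain ⟨r, f, h0, hr, hadj, hne, hs⟩ := hK.exists_shortest
  have hmem : ∀ i ≤ r, f i ∈ B := by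
    intro i hi
    rcases hi.lt_or_eq with hi | rfl
    · exact (hadj i hi).2.1
    · exact hr ▸ ha
  refine ⟨r, f, Nat.pos_of_ne_zero ?_, h0, hr, hmem, fun i j hij hj => ⟨hne i j hij hj, ?_, ?_⟩⟩
  · rintro rfl
    exact hca (h0.symm.trans hr)
  · exact fun h => hs i j hij hj ⟨h, hmem i (by omega), hmem j hj⟩
  · rintro rfl
    exact (hadj i (by omega)).1

/-- A branch of a bracelet at a cut-vertex `c` contains a long induced path or a large block. -/
theorem exists_path_and_biconn_of_branch [Finite V] (hG : G.Connected)
    (hcut : ∀ v, G.IsCutVertex v → {B : Set V | G.IsBlock B ∧ v ∈ B}.encard = 2)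
    (hblk : ∀ B, G.IsBlock B → {v | v ∈ B ∧ G.IsCutVertex v}.encard ≤ 2) (n : ℕ) :
    ∀ (D : Set V) (c : V), D.ncard = n → G.ConnSet D → c ∉ D →
      (∀ x ∈ D, ∀ y, G.Adj x y → y ∈ D ∨ y = c) → (∃ x ∈ D, G.Adj c x) → G.IsCutVertex c →
      ∃ (t : ℕ) (B : Set V) (L : List V), 1 ≤ t ∧ G.Biconn B ∧ D.ncard + t ≤ t * B.ncard ∧
        G.IsIndList (c :: L) ∧ (∀ x ∈ L, x ∈ D) ∧ t ≤ L.length := by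
  induction n using Nat.strong_induction_on with
  | _ n ih =>
  rintro D c hn hD hcD hN ⟨d, hd, hcd⟩ hc
  obtain ⟨B, hB, hcB, hdB⟩ := hcd.exists_maximal_biconn
  have hBD : B ⊆ insert c D := hB.1.subset_insert hdB hd hcD hN
  by_cases hDB : D ⊆ B
  -- The end of the chain. In general `t` counts the blocks crossed and `B` is a largest of them.
  · refine ⟨1, B, [d], le_rfl, hB.1, ?_, ⟨hcd, by simp, by simpa using hcd.ne, trivial⟩,
      by simpa using hd, by simp⟩
    rw [one_mul, ← Set.ncard_insert_of_notMem hcD]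
    exact Set.ncard_le_ncard (Set.insert_subset hcB hDB)
  obtain ⟨x, hxD, hxB⟩ := Set.not_subset.1 hDB
  have hbranch : ∀ a ∈ B, ∀ b ∉ B, a ∈ D → b ∈ D → G.Adj a b → G.IsCutVertex a :=
    fun a ha b hb haD hbD hab => isCutVertex_of_not_linked (y := c) hG hab.ne'
      (fun e => hcD (e ▸ haD))
      (not_linked_of_maximal_biconn hB ha hb hab hcB)
  obtain ⟨a, haB, b, hbB, haD, hbD, hab⟩ := (hD.2 d hd x hxD).exists_adj_boundary hdB hxB
  have hca : c ≠ a := fun e => hcD (e ▸ haD)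
  have hacut := hbranch a haB b hbB haD hbD hab
  set D' := G.compIn {a}ᶜ b with hD'
  have hbD' : b ∈ D' := mem_compIn_self hab.ne'
  have haD' : a ∉ D' := fun h => compIn_subset h rfl
  have hD'B : ∀ y ∈ D', y ∉ B := fun y hy hyB =>
    not_linked_of_maximal_biconn hB haB hbB hab hyB hy
  have hD'D : D' ⊆ D := by
    intro y hy
    by_contra hyD
    obtain ⟨p, hp, q, hq, -, hqD', hpq⟩ := (Linked.compIn hy).exists_adj_boundary hbD hyD
    rcases hN p hp q hpq with h | rfl
    · exact hq h
    -- `D'` could leave `D` only through `c`, which lies in `B`, and `D'` misses `B`.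
    · exact hD'B q hqD' hcB
  -- A further exit from `B` inside `D` would be either a third branch at `a` or, at another vertex
  -- `a2`, a third cut-vertex of `B` besides `c` and `a`.
  have hcover : D ⊆ B ∪ D' := by
    intro z hz
    by_contra hzn
    obtain ⟨a2, ha2, b2, hb2, ha2D, hb2D, hab2⟩ := (hD.2 d hd z hz).exists_adj_boundary
      (C := B ∪ D') (.inl hdB) hzn
    simp only [Set.mem_union, not_or] at hb2
    rcases ha2 with ha2 | ha2
    · by_cases e : a2 = a
      · subst e
        refine not_three_branches hG (hcut a2 hacut).le ![c, b, b2] ?_ ?_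
        · intro i; fin_cases i; exacts [hca, hab.ne', hab2.ne']
        · have h1 := not_linked_of_maximal_biconn hB haB hbB hab hcB
          have h2 := not_linked_of_maximal_biconn hB haB hb2.1 hab2 hcB
          have h3 : ¬ G.Linked {a2}ᶜ b b2 := hb2.2
          intro i j hij
          fin_cases i <;> fin_cases j <;> first | exact absurd rfl hij | skip
          exacts [fun h => h1 h.symm, fun h => h2 h.symm, h1, h3, h2, fun h => h3 h.symm]
      · have ha2cut := hbranch a2 ha2 b2 hb2.1 ha2D hb2D hab2
        have hca2 : c ≠ a2 := fun e => hcD (e ▸ ha2D)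
        have h3 : ({c, a, a2} : Set V).encard = 3 :=
          Set.encard_eq_three.2 ⟨c, a, a2, hca, hca2, Ne.symm e, rfl⟩
        have h4 : ({c, a, a2} : Set V).encard ≤ 2 := by
          refine (Set.encard_le_encard ?_).trans (hblk B (isBlock_of_maximal_biconn hB))
          rintro w (rfl | rfl | rfl)
          exacts [⟨hcB, hc⟩, ⟨haB, hacut⟩, ⟨ha2, ha2cut⟩]
        rw [h3] at h4
        exact absurd h4 (by decide)
    · rcases compIn_compl_closed a2 ha2 b2 hab2 with h | rfl
      exacts [hb2.2 h, hb2.1 haB]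
  have hlt : D'.ncard < D.ncard := Set.ncard_lt_ncard ⟨hD'D, fun h => haD' (h haD)⟩
  obtain ⟨t, B', L, ht, hB', hcard, hL, hLD, htL⟩ := ih _ (hn ▸ hlt) D' a rfl
    (connSet_compIn hab.ne') haD' compIn_compl_closed ⟨b, hbD', hab⟩ hacut
  obtain ⟨r, f, hr, hf0, hfr, hfB, hf⟩ := hB.1.conn.exists_shortest hcB haB hca
  obtain ⟨L', hL'l, hL', hL'm⟩ := (hfr.symm ▸ hL : G.IsIndList (f r :: L)).prepend_path r f hf (by
    intro k hk y hy
    have hyD' := hLD y hy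
    refine ⟨fun h => ?_, fun e => hD'B y hyD' (e ▸ hfB k hk.le)⟩
    rcases compIn_compl_closed y hyD' _ h.symm with h' | h'
    · exact hD'B _ h' (hfB k hk.le)
    · exact (hf k r hk le_rfl).1 (h'.trans hfr.symm))
  have hsum : D.ncard + 1 ≤ B.ncard + D'.ncard := by
    rw [← Set.ncard_insert_of_notMem hcD]
    refine (Set.ncard_le_ncard ?_).trans (Set.ncard_union_le _ _)
    exact Set.insert_subset (.inl hcB) hcover
  have hmem : ∀ x ∈ L', x ∈ D := by
    intro x hx
    rcases hL'm x hx with h | ⟨k, hk, hkr, rfl⟩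
    · exact hD'D (hLD x h)
    · rcases hBD (hfB k hkr) with h | h
      · exact absurd (hf0.trans h.symm) (hf 0 k hk hkr).1
      · exact h
  -- From `|D| + 1 ≤ |B| + |D'|` and `|D'| + t ≤ t * |B'|`, the larger of `B` and `B'` serves for `t
  -- + 1`.
  rcases le_total B.ncard B'.ncard with h | h
  · exact ⟨t + 1, B', L', by omega, hB', by rw [add_mul, one_mul]; omega, hf0 ▸ hL', hmem, by omega⟩
  · refine ⟨t + 1, B, L', by omega, hB.1, ?_, hf0 ▸ hL', hmem, by omega⟩
    have := Nat.mul_le_mul_left t h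
    rw [add_mul, one_mul]
    omega

/-- A bracelet contains a long induced path or a large biconnected set. -/
theorem IsBracelet.exists_path_and_biconn [Finite V] (hG : G.IsBracelet) (hV : 2 ≤ Nat.card V) :
    ∃ (t : ℕ) (B : Set V) (l : List V), 1 ≤ t ∧ G.Biconn B ∧ Nat.card V ≤ 2 * t * B.ncard ∧
      G.IsIndList l ∧ t ≤ l.length := by
  obtain ⟨hconn, -, hcut, hblk⟩ := hG
  by_cases h : ∃ c, G.IsCutVertex c
  · obtain ⟨c, hc⟩ := h
    obtain ⟨x, y, -, hxy⟩ := id hc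
    have hl : ¬ G.Linked {c}ᶜ x y := fun h => hxy (reachable_induce_iff.2 h)
    -- A cut-vertex has only two branches, so the larger one has at least `(n - 1) / 2` vertices.
    have hcover : Set.univ ⊆ insert c (G.compIn {c}ᶜ x ∪ G.compIn {c}ᶜ y) := by
      intro z _
      by_contra hz
      simp only [Set.mem_insert_iff, Set.mem_union, not_or] at hz
      refine not_three_branches hconn (hcut c hc).le ![x, y, z] ?_ ?_
      · intro i; fin_cases i; exacts [x.2, y.2, hz.1]
      · intro i j hij
        fin_cases i <;> fin_cases j <;> first | exact absurd rfl hij | skip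
        exacts [hl, hz.2.1, fun h => hl h.symm, hz.2.2, fun h => hz.2.1 h.symm,
          fun h => hz.2.2 h.symm]
    have hcard : Nat.card V ≤ (G.compIn {c}ᶜ x).ncard + (G.compIn {c}ᶜ y).ncard + 1 := by
      rw [← Set.ncard_univ]
      refine (Set.ncard_le_ncard hcover).trans ((Set.ncard_insert_le _ _).trans ?_)
      exact Nat.add_le_add_right (Set.ncard_union_le _ _) 1
    obtain ⟨z, hz, hzcard⟩ : ∃ z, z ≠ c ∧ Nat.card V ≤ 2 * (G.compIn {c}ᶜ z).ncard + 1 := by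
      rcases le_total (G.compIn {c}ᶜ (x : V)).ncard (G.compIn {c}ᶜ (y : V)).ncard with h | h
      · exact ⟨y, y.2, by omega⟩
      · exact ⟨x, x.2, by omega⟩
    obtain ⟨t, B, L, ht, hB, hcB, hL, -, htL⟩ := exists_path_and_biconn_of_branch hconn hcut hblk _
      (G.compIn {c}ᶜ z) c rfl (connSet_compIn hz) (fun h => compIn_subset h rfl) compIn_compl_closed
      (exists_adj_compIn hconn hz) hc
    refine ⟨t, B, c :: L, ht, hB, ?_, hL, by simp; omega⟩
    rw [mul_assoc]
    omega
  · push Not at h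
    have : Nontrivial V := Finite.one_lt_card_iff_nontrivial.1 hV
    -- Without cut-vertices the whole graph is biconnected, so `t = 1` and a one-vertex path
    -- suffice.
    obtain ⟨v⟩ := hconn.nonempty
    refine ⟨1, Set.univ, [v], le_rfl, ⟨Set.nontrivial_univ, connSet_univ_iff.2 hconn, fun w => ?_⟩,
      by rw [Set.ncard_univ]; omega, trivial, by simp⟩
    rw [← Set.compl_eq_univ_sdiff]
    refine ⟨exists_ne w, fun x hx y hy => ?_⟩
    by_contra hl
    exact h w (isCutVertex_of_not_linked hconn hx hy hl)

theorem Biconn.exists_inducedPath [Finite V] (hθ : G.ThetaFree) (hK : G.EdgeK4Free) {B : Set V}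
    (hB : G.Biconn B) : ∃ k, G.HasInducedPath k ∧ B.ncard ≤ 4 ^ k := by
  obtain ⟨l, hl, hcard⟩ := exists_induced_path_of_twoConnected (hθ.induce B) (hK.induce B)
    (connSet_univ_iff.2 (connected_induce_iff_connSet.2 hB.conn)) (fun w => by
      rw [connSet_induce_iff]
      convert hB.conn_diff w
      ext x
      constructor
      · rintro ⟨y, hy, rfl⟩
        exact ⟨y.2, fun e => hy (Subtype.ext e)⟩
      · rintro ⟨hx, hxv⟩
        exact ⟨⟨x, hx⟩, fun e => hxv (congrArg Subtype.val e), rfl⟩)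
  obtain ⟨φ⟩ := hl.hasInducedPath
  exact ⟨l.length, ⟨φ.trans (Embedding.induce B)⟩, by rwa [← Nat.card_coe_set_eq]⟩

end SimpleGraph

/-! ### Numerical estimates and conclusion -/

theorem bracelet_bound_of_le_mul_pow {n t k : ℕ} (hn : 2 ≤ n) (ht : 1 ≤ t)
    (hlog : 2 * (t : ℝ) ≤ Real.logb 2 n) (h : n ≤ 2 * t * 4 ^ k) :
    (1 / 2 : ℝ) * (Real.logb 2 n - Real.logb 2 (Real.logb 2 n)) ≤ k := by
  have hn' : (0 : ℝ) < n := by positivity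
  have ht' : (1 : ℝ) ≤ t := by exact_mod_cast ht
  have hL : 0 < Real.logb 2 n := by linarith
  have h1 : (n : ℝ) ≤ Real.logb 2 n * 4 ^ k := by
    have : (n : ℝ) ≤ 2 * t * 4 ^ k := by exact_mod_cast h
    exact this.trans (by gcongr)
  have h2 := Real.logb_le_logb_of_le (b := 2) (by norm_num) hn' h1
  rw [Real.logb_mul hL.ne' (by positivity), Real.logb_pow,
    show (4 : ℝ) = 2 ^ (2 : ℕ) by norm_num, Real.logb_pow, Real.logb_self_eq_one (by norm_num)] at h2
  push_cast at h2
  linarith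

theorem one_le_logb_two {n : ℕ} (hn : 2 ≤ n) : 1 ≤ Real.logb 2 n := by
  rw [Real.le_logb_iff_rpow_le (by norm_num) (by positivity), Real.rpow_one]
  exact_mod_cast hn

theorem tendsto_loglog_div_log :
    Tendsto (fun n : ℕ => (1 / 2 : ℝ) * (Real.logb 2 (Real.logb 2 n) / Real.logb 2 n)) atTop
      (𝓝 0) := by
  have h1 : Tendsto (fun x : ℝ => Real.logb 2 x / x) atTop (𝓝 0) := by
    have h := (Real.isLittleO_log_id_atTop.tendsto_div_nhds_zero).div_const (Real.log 2)
    rw [zero_div] at h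
    refine h.congr fun x => ?_
    simp only [Real.logb, id]
    ring
  have h2 : Tendsto (fun n : ℕ => Real.logb 2 n) atTop atTop :=
    (Real.tendsto_logb_atTop (by norm_num)).comp tendsto_natCast_atTop_atTop
  simpa using (h1.comp h2).const_mul (1 / 2 : ℝ)

theorem lemma3p4 :
    (∀ (V : Type*) [Fintype V] (G : SimpleGraph V) (n : ℕ), G.IsBracelet → Fintype.card V = n →
      2 ≤ n →
      ∃ k : ℕ, (1 / 2 : ℝ) * (Real.logb 2 n - Real.logb 2 (Real.logb 2 n)) ≤ k ∧
        G.HasInducedPath k) ∧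
    ∃ ε : ℕ → ℝ, Tendsto ε atTop (𝓝 0) ∧ ∀ n : ℕ, 2 ≤ n →
      (1 / 2 : ℝ) * (Real.logb 2 n - Real.logb 2 (Real.logb 2 n)) =
        (1 / 2 - ε n) * Real.logb 2 n := by
  refine ⟨fun V _ G n hG hcard hn => ?_, _, tendsto_loglog_div_log, fun n hn => ?_⟩
  · rw [← Nat.card_eq_fintype_card] at hcard
    obtain ⟨t, B, l, ht, hB, hnB, hl, htl⟩ := hG.exists_path_and_biconn (hcard ▸ hn)
    -- Few blocks: a path inside the large block. Many blocks: the path across them has at least `t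
    -- > (log n) / 2` vertices, and `log log n ≥ 0`.
    by_cases hlog : 2 * (t : ℝ) ≤ Real.logb 2 n
    · obtain ⟨k, hk, hBk⟩ := hB.exists_inducedPath hG.2.1.thetaFree hG.2.1.edgeK4Free
      refine ⟨k, bracelet_bound_of_le_mul_pow hn ht hlog ?_, hk⟩
      rw [← hcard]
      exact hnB.trans (Nat.mul_le_mul_left _ hBk)
    · refine ⟨l.length, ?_, hl.hasInducedPath⟩
      have h1 : 0 ≤ Real.logb 2 (Real.logb 2 n) :=
        Real.logb_nonneg (by norm_num) (one_le_logb_two hn)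
      have h2 : (t : ℝ) ≤ l.length := by exact_mod_cast htl
      linarith
  · have := one_le_logb_two hn
    field_simp
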